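/- **Model (TSO).** There are $n$ processes. Each process $i$ has a FIFO store buffer and a local dispatcher $d_i$; processes and dispatchers are the agents. A write by $i$ appends a pair (variable, value) to $i$'s buffer. A read of $x$ by $i$ returns the latest value for $x$ in $i$'s buffer if there is one, and the value of $x$ in memory otherwise. A fence $\mathtt F$ by $i$ is enabled only if $i$'s buffer is empty; $\mathtt{RMW}[x,v_{\exp},v_{\rm new}]$ is enabled only if $i$'s buffer is empty and $x=v_{\exp}$ in memory, and it sets $x$ to $v_{\rm new}$ in memory. A propagate action of $d_i$ is enabled when $i$'s buffer is nonempty; it moves the oldest pair to memory. Processes may also perform internal and $\mathtt{return}$ actions. The local state of a process is the list of its invocations and of its non-null actions so far, with the values read. A run is a sequence of global states (memory, buffers, local states), starting with empty buffers and empty local states. In the round from time $t$ to time $t+1$ every agent performs an enabled action or the null action, no two of these actions conflict, and the environment may invoke an operation at processes with no pending operation. Two actions conflict if both access the same variable in memory (as an $\mathtt{RMW}$, a propagation or a read from memory), they are not both reads from memory, and they are not a propagation by $d_i$ together with a read from memory by $i$. A protocol assigns to each process and local state a nonempty set of permitted actions; in a run of an implementation, all non-null actions of processes are permitted by its protocol.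 Each value is written to the register at most once in a run. A run is fair if every nonempty buffer eventually has a propagation and every process that from some time on always has an enabled permitted non-null action eventually moves. **Operations.** An operation $X$ of process $i$ invoked in the round from time $t$ to time $t+1$ starts at time $t_{X.s}=t$; if its return action is performed in the round from time $t'-1$ to time $t'$, it ends at time $t_{X.e}=t'$. Write $X<_r Y$ if $t_{X.e}<t_{Y.s}$ in $r$; $X$ runs in isolation in $r$ if every other operation $Y$ of $r$ satisfies $X<_rY$ or $Y<_rX$. $X$ runs solo if at times $t_{X.s}\le t<t_{X.e}$ no agent other than $i$ and $d_i$ moves. $X$ contains an action if $i$ performs it after the invocation of $X$ and no later than its return. An operation on value $a$ is a $\mathsf{Read}$ that returns $a$ or a $\mathsf{Write}$ of $a$. A register implementation is linearizable if every fair run of it is linearizable with respect to the register with a fixed default value. It is obstruction-free if, whenever from some time on only one process $i$ and its dispatcher move, both being scheduled fairly, a pending operation of $i$ completes. **Theorem.** Let $\mathcal I$ be an obstruction-free linearizable implementation in TSO of a multi-writer multi-reader register, and let $a\ne b$ be register values. Let $r$ be a run of $\mathcal I$ in which an operation $X$ on value $a$ of process $i$ runs solo and in isolation and completes, such that no $\mathsf{Write}(b)$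 is invoked in $r$ before the end of $X$. Suppose that $X$ contains neither $\mathtt F$ nor $\mathtt{RMW}$ actions in $r$. Then for every process $j\neq i$ there is a fair run $\tilde r$ of $\mathcal I$ such that * process $i$ has the same local state in $\tilde r$ as in $r$ at every time up to the end of $X$; in particular $X$ occurs in $\tilde r$, with the same start, end and response; * in $\tilde r$, process $j$ performs a $\mathsf{Write}(b)$ that completes, with $X<_{\tilde r}\mathsf{Write}(b)$, and this $\mathsf{Write}(b)$ contains an $\mathtt F$ or an $\mathtt{RMW}$ action in $\tilde r$. -/

import Mathlib

namespace TSO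

/-! ### Register operations, actions, recorded events

`X` is the set of shared variables, `D` the set of values that variables hold, `A` the set of
values of the implemented register, `L` a set of labels of internal actions.
Processes are the elements of `Fin n`; process `i` has a local dispatcher `d_i`. -/

/-- The operations of a register. -/
inductive Op (A : Type*) where
  | read : Op A
  | write (v : A) : Op A

/-- The responses of register operations. -/
inductive Resp (A : Type*) where
  | value (v : A) : Resp A
  | ack : Resp A

/-- A response of the right kind: a value for a read, an acknowledgment for a write. -/
def Resp.Fits {A : Type*} : Resp A → Op A → Prop
  | .value _, .read => True
  | .ack, .write _ => True
  | _, _ => False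

/-- The actions of a process. `null` is the null action, `ret p` returns response `p` to the
pending operation, `internal l` only changes the local state. -/
inductive Act (X D A L : Type*) where
  | null : Act X D A L
  | read (x : X) : Act X D A L
  | write (x : X) (v : D) : Act X D A L
  | fence : Act X D A L
  | rmw (x : X) (exp new : D) : Act X D A L
  | internal (l : L) : Act X D A L
  | ret (p : Resp A) : Act X D A L

/-- The action is a fence or a read-modify-write. -/
def Act.IsSync {X D A L : Type*} : Act X D A L → Prop
  | .fence => True
  | .rmw _ _ _ => True
  | _ => False

/-- The records that make up a local state. A read is recorded with the value returned, but not
with its source (buffer or memory). -/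
inductive Event (X D A L : Type*) where
  | read (x : X) (v : D) : Event X D A L
  | write (x : X) (v : D) : Event X D A L
  | fence : Event X D A L
  | rmw (x : X) (exp new : D) : Event X D A L
  | internal (l : L) : Event X D A L
  | ret (p : Resp A) : Event X D A L
  | invoke (o : Op A) : Event X D A L

/-- A local state is the list of all records so far, oldest first. -/
abbrev Local (X D A L : Type*) := List (Event X D A L)

/-- Effect of one record on the operation currently pending. -/
def Event.updPending {X D A L : Type*} (q : Option (Op A)) : Event X D A L → Option (Op A)
  | .invoke o => some o
  | .ret _ => none
  | _ => q

/-- The operation that is pending at a process with the given local state, if any. -/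
def pending {X D A L : Type*} (l : Local X D A L) : Option (Op A) :=
  l.foldl Event.updPending none

/-! ### TSO states, joint actions and their effect -/

/-- Main memory, and for each process a store buffer (oldest item first). -/
structure MemState (n : ℕ) (X D : Type*) where
  mem : X → D
  buf : Fin n → List (X × D)

/-- A global state: a TSO state and a local state for every process. -/
structure Global (n : ℕ) (X D A L : Type*) where
  tso : MemState n X D
  loc : Fin n → Local X D A L

/-- A joint action: an action for each process, for each dispatcher whether it propagates
(`true`) or performs the null action (`false`), and at most one invocation per process by the
environment. -/
structure Joint (n : ℕ) (X D A L : Type*) where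
  proc : Fin n → Act X D A L
  disp : Fin n → Bool
  env : Fin n → Option (Op A)

/-- The value of the latest item for `x` in a buffer, if there is one. -/
def bufLookup {X D : Type*} [DecidableEq X] (β : List (X × D)) (x : X) : Option D :=
  ((β.filter fun p => p.1 = x).getLast?).map Prod.snd

/-- The value returned to `i` by a read of `x`: from `i`'s buffer if it holds an item for `x`,
and otherwise from memory. -/
def readVal {n : ℕ} {X D : Type*} [DecidableEq X] (σ : MemState n X D) (i : Fin n) (x : X) : D :=
  (bufLookup (σ.buf i) x).getD (σ.mem x)

/-- Precondition of an action of process `i` in a global state. -/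
def ActEnabled {n : ℕ} {X D A L : Type*} (g : Global n X D A L) (i : Fin n) :
    Act X D A L → Prop
  | .fence => g.tso.buf i = []
  | .rmw x exp _ => g.tso.buf i = [] ∧ g.tso.mem x = exp
  | .ret p => ∃ o, pending (g.loc i) = some o ∧ p.Fits o
  | _ => True

/-- Effect of an action of process `i` on the TSO state. -/
def actEffect {n : ℕ} {X D A L : Type*} [DecidableEq X] (σ : MemState n X D) (i : Fin n) :
    Act X D A L → MemState n X D
  | .write x v => { σ with buf := Function.update σ.buf i (σ.buf i ++ [(x, v)]) }
  | .rmw x _ new => { σ with mem := Function.update σ.mem x new }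
  | _ => σ

/-- Effect of a propagate action of the dispatcher of `i` on the TSO state. -/
def propEffect {n : ℕ} {X D : Type*} [DecidableEq X] (σ : MemState n X D) (i : Fin n) :
    MemState n X D :=
  match σ.buf i with
  | [] => σ
  | (x, v) :: β => ⟨Function.update σ.mem x v, Function.update σ.buf i β⟩

/-- The record of an action of process `i` performed in the TSO state `σ`. -/
def record {n : ℕ} {X D A L : Type*} [DecidableEq X] (σ : MemState n X D) (i : Fin n) :
    Act X D A L → Local X D A L
  | .null => []
  | .read x => [.read x (readVal σ i x)]
  | .write x v => [.write x v]
  | .fence => [.fence]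
  | .rmw x exp new => [.rmw x exp new]
  | .internal l => [.internal l]
  | .ret p => [.ret p]

/-- The agents: processes and local dispatchers. -/
inductive Agent (n : ℕ) where
  | proc (i : Fin n) : Agent n
  | disp (i : Fin n) : Agent n

/-- In `σ` under `a`, the agent reads `x` from memory. -/
def ReadsMem {n : ℕ} {X D A L : Type*} [DecidableEq X] (σ : MemState n X D)
    (a : Joint n X D A L) : Agent n → X → Prop
  | .proc i, x => a.proc i = .read x ∧ bufLookup (σ.buf i) x = none
  | .disp _, _ => False

/-- In `σ` under `a`, the agent propagates an item for `x`. -/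
def Propagates {n : ℕ} {X D A L : Type*} (σ : MemState n X D)
    (a : Joint n X D A L) : Agent n → X → Prop
  | .proc _, _ => False
  | .disp i, x => a.disp i = true ∧ ∃ v β, σ.buf i = (x, v) :: β

/-- Under `a`, the agent performs a read-modify-write on `x`. -/
def Rmws {n : ℕ} {X D A L : Type*} (a : Joint n X D A L) : Agent n → X → Prop
  | .proc i, x => ∃ exp new, a.proc i = .rmw x exp new
  | .disp _, _ => False

/-- In `σ` under `a`, the agent accesses the variable `x` in memory. -/
def Accesses {n : ℕ} {X D A L : Type*} [DecidableEq X] (σ : MemState n X D)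
    (a : Joint n X D A L) (b : Agent n) (x : X) : Prop :=
  ReadsMem σ a b x ∨ Propagates σ a b x ∨ Rmws a b x

/-- The agents `b` and `c` access the same variable, not both by reading it from memory, and it is
not the case that one of them is a dispatcher `d_i` that propagates and the other is process `i`
that reads from memory. -/
def Conflict {n : ℕ} {X D A L : Type*} [DecidableEq X] (σ : MemState n X D)
    (a : Joint n X D A L) (b c : Agent n) : Prop :=
  ∃ x, Accesses σ a b x ∧ Accesses σ a c x ∧
    ¬ (ReadsMem σ a b x ∧ ReadsMem σ a c x) ∧
    ¬ (∃ i, b = .disp i ∧ c = .proc i ∧ Propagates σ a b x ∧ ReadsMem σ a c x) ∧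
    ¬ (∃ i, c = .disp i ∧ b = .proc i ∧ Propagates σ a c x ∧ ReadsMem σ a b x)

/-- A joint action is enabled in `g` if each of its components is, and no two of them conflict.
The environment, which acts last in a round, invokes an operation at `i` only if no operation is
then pending at `i`. -/
structure JointEnabled {n : ℕ} {X D A L : Type*} [DecidableEq X] (g : Global n X D A L)
    (a : Joint n X D A L) : Prop where
  proc : ∀ i, ActEnabled g i (a.proc i)
  disp : ∀ i, a.disp i = true → g.tso.buf i ≠ []
  env : ∀ i, a.env i ≠ none → pending (g.loc i ++ record g.tso i (a.proc i)) = none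
  no_conflict : ∀ b c, b ≠ c → ¬ Conflict g.tso a b c

/-- The global state that results from a joint action: the actions of the processes, in order,
then those of the dispatchers, in order, are applied to the TSO state; and the
actions and invocations are recorded in the local states. -/
def next {n : ℕ} {X D A L : Type*} [DecidableEq X] (g : Global n X D A L)
    (a : Joint n X D A L) : Global n X D A L where
  tso := (List.finRange n).foldl (fun σ i => if a.disp i then propEffect σ i else σ)
    ((List.finRange n).foldl (fun σ i => actEffect σ i (a.proc i)) g.tso)
  loc := fun i => g.loc i ++ record g.tso i (a.proc i) ++
    ((a.env i).map Event.invoke).toList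

/-! ### Implementations and their runs -/

/-- An implementation: a nondeterministic protocol for each process (the set of actions that it
may perform in each local state), and the permitted initial contents of the memory. -/
structure Implementation (n : ℕ) (X D A L : Type*) where
  protocol : Fin n → Local X D A L → Set (Act X D A L)
  protocol_nonempty : ∀ i l, (protocol i l).Nonempty
  initMem : Set (X → D)

/-- A sequence of global states, with the joint action `act t` taking `state t` to
`state (t + 1)`. -/
structure Run (n : ℕ) (X D A L : Type*) where
  state : ℕ → Global n X D A L
  act : ℕ → Joint n X D A L

/-- `r` is an execution of `I`, with no assumption on the fairness of scheduling. As a standing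
assumption on the environment, each value is written to the register at most once. -/
structure IsExecution {n : ℕ} {X D A L : Type*} [DecidableEq X] (I : Implementation n X D A L)
    (r : Run n X D A L) : Prop where
  mem_zero : (r.state 0).tso.mem ∈ I.initMem
  buf_zero : ∀ i, (r.state 0).tso.buf i = []
  loc_zero : ∀ i, (r.state 0).loc i = []
  enabled : ∀ t, JointEnabled (r.state t) (r.act t)
  step : ∀ t, r.state (t + 1) = next (r.state t) (r.act t)
  follows : ∀ t i, (r.act t).proc i ≠ .null →
    (r.act t).proc i ∈ I.protocol i ((r.state t).loc i)
  write_once : ∀ v t t' i i', (r.act t).env i = some (.write v) →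
    (r.act t').env i' = some (.write v) → t = t' ∧ i = i'

/-- The protocol of `i` allows a non-null action that is enabled in `g`. -/
def CanMove {n : ℕ} {X D A L : Type*} (I : Implementation n X D A L) (g : Global n X D A L)
    (i : Fin n) : Prop :=
  ∃ a ∈ I.protocol i (g.loc i), a ≠ .null ∧ ActEnabled g i a

/-- Fair scheduling of process `i`: if from some time on it can always move, then it does. -/
def FairProc {n : ℕ} {X D A L : Type*} (I : Implementation n X D A L) (r : Run n X D A L)
    (i : Fin n) : Prop :=
  ∀ T, (∀ t, T ≤ t → CanMove I (r.state t) i) → ∃ t, T ≤ t ∧ (r.act t).proc i ≠ .null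

/-- Fair scheduling of the dispatcher of `i`: an enabled propagate action is eventually
performed. -/
def FairDisp {n : ℕ} {X D A L : Type*} (r : Run n X D A L) (i : Fin n) : Prop :=
  ∀ T, (r.state T).tso.buf i ≠ [] → ∃ t, T ≤ t ∧ (r.act t).disp i = true

/-- All processes and all dispatchers are scheduled fairly. -/
def IsFair {n : ℕ} {X D A L : Type*} (I : Implementation n X D A L) (r : Run n X D A L) : Prop :=
  ∀ i, FairProc I r i ∧ FairDisp r i

/-! ### Operations in a run

An operation in a run is given by its process `i` and its starting time `s`: the
environment invokes it at `i` in the round from time `s` to time `s + 1`. -/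

/-- Operation `o` is invoked at `α.1` at time `α.2`. -/
def Invoked {n : ℕ} {X D A L : Type*} (r : Run n X D A L) (α : Fin n × ℕ) (o : Op A) : Prop :=
  (r.act α.2).env α.1 = some o

/-- The operation `α` ends at time `e`, that is, its matching return action is performed in the
round from time `e - 1` to time `e`, and the response is `p`. -/
def EndsAt {n : ℕ} {X D A L : Type*} (r : Run n X D A L) (α : Fin n × ℕ) (e : ℕ) (p : Resp A) :
    Prop :=
  ∃ t, e = t + 1 ∧ α.2 < t ∧ (r.act t).proc α.1 = .ret p ∧
    ∀ u, α.2 < u → u < t → ∀ q, (r.act u).proc α.1 ≠ .ret q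

/-- Real-time order: `α` ends strictly before the starting time of `β`. -/
def Precedes {n : ℕ} {X D A L : Type*} (r : Run n X D A L) (α β : Fin n × ℕ) : Prop :=
  ∃ e p, EndsAt r α e p ∧ e < β.2

/-- No operation of `r` is concurrent with `α`. -/
def InIsolation {n : ℕ} {X D A L : Type*} (r : Run n X D A L) (α : Fin n × ℕ) : Prop :=
  ∀ β o, Invoked r β o → β ≠ α → Precedes r α β ∨ Precedes r β α

/-- No agents other than `i` and its dispatcher move at times `t` with `s ≤ t < e`. -/
def Solo {n : ℕ} {X D A L : Type*} (r : Run n X D A L) (i : Fin n) (s e : ℕ) : Prop :=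
  ∀ t, s ≤ t → t < e → ∀ k, k ≠ i → (r.act t).proc k = .null ∧ (r.act t).disp k = false

/-- Process `i` performs a fence or a read-modify-write after the invocation at time `s` and
before time `e`. (The action of `i` at time `s` itself is chosen before the invocation.) -/
def ContainsSync {n : ℕ} {X D A L : Type*} (r : Run n X D A L) (i : Fin n) (s e : ℕ) : Prop :=
  ∃ t, s < t ∧ t < e ∧ ((r.act t).proc i).IsSync

/-- An operation with response `p` that is a read returning `v` or a write of `v`. -/
def IsValueOp {A : Type*} (v : A) (o : Op A) (p : Resp A) : Prop :=
  (o = .read ∧ p = .value v) ∨ (o = .write v ∧ p = .ack)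

/-! ### Correctness conditions -/

/-- The run is linearizable with respect to the register with default value `v₀`: there are a set
`C` of operations of `r`, which contains every operation that completes (and possibly some that do
not), and a linear order on `C`, given by distinct positions, that extends the real-time order and
in which every completed read returns the value of the last write before it, or `v₀` if there is no
write before it. -/
def LinearizableRun {n : ℕ} {X D A L : Type*} (v₀ : A) (r : Run n X D A L) : Prop :=
  ∃ (C : Set (Fin n × ℕ)) (pos : Fin n × ℕ → ℕ),
    (∀ α ∈ C, ∃ o, Invoked r α o) ∧
    (∀ α o e p, Invoked r α o → EndsAt r α e p → α ∈ C) ∧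
    Set.InjOn pos C ∧
    (∀ α ∈ C, ∀ β ∈ C, Precedes r α β → pos α < pos β) ∧
    ∀ α e v, Invoked r α .read → EndsAt r α e (.value v) →
      (∃ β ∈ C, Invoked r β (.write v) ∧ pos β < pos α ∧
        ∀ γ ∈ C, ∀ w, Invoked r γ (.write w) → pos γ < pos α → pos γ ≤ pos β) ∨
      (v = v₀ ∧ ∀ γ ∈ C, ∀ w, Invoked r γ (.write w) → ¬ pos γ < pos α)

/-- `I` is a linearizable implementation of a register with default value `v₀`. -/
def Linearizable {n : ℕ} {X D A L : Type*} [DecidableEq X] (I : Implementation n X D A L)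
    (v₀ : A) : Prop :=
  ∀ r, IsExecution I r → IsFair I r → LinearizableRun v₀ r

/-- `I` is obstruction-free: if from some time on only process `i` and its dispatcher move, and
these are scheduled fairly, then an operation that is pending at `i` completes. -/
def ObstructionFree {n : ℕ} {X D A L : Type*} [DecidableEq X] (I : Implementation n X D A L) :
    Prop :=
  ∀ r, IsExecution I r → ∀ i T, pending ((r.state T).loc i) ≠ none →
    (∀ e, Solo r i T e) → FairProc I r i → FairDisp r i →
    ∃ t p, T ≤ t ∧ (r.act t).proc i = .ret p

/-- Process `i` has the same local states in `r` and `r'` until time `e`. -/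
def IndistUntil {n : ℕ} {X D A L : Type*} (r r' : Run n X D A L) (i : Fin n) (e : ℕ) : Prop :=
  ∀ t, t ≤ e → (r'.state t).loc i = (r.state t).loc i

end TSO

/-! A process that performs neither fences nor RMWs cannot tell whether its own writes have reached
memory: a propagation by its own dispatcher leaves what it reads unchanged (`readVal_propEffect`).
While it runs solo, its local states therefore depend only on its initial view and its own actions.
A `Trace` records exactly this, and `Trace.block_state` replays it with no propagation at all:
memory and all other processes stay untouched, and the items written pile up in the process's own
buffer, where nobody else sees them.

Suppress in this way all propagations during `X`, and then let `j` perform `Write(b)` solo, which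
completes by obstruction-freedom (`InitSeg.exists_opSeg`). If this write contains a fence or an RMW,
any fair continuation (`InitSeg.exists_fair`) gives the required run.

Otherwise `X` and `Write(b)` are both sync-free traces. Since `j` did not see the items of `X`, both
traces start from the same state, the one in which `X` has not been invoked. By `Trace.exists_opSeg`
they can be replayed from it in either order, and `Global.frozen_comm` shows that the two orders end
in the same global state. This is impossible (`false_of_traces`). If `X` is a read, it still returns
`a` when replayed after `Write(b)`. If `X` is a write, a subsequent read of `j` is the same after
both orders, but must return the value written last, which is `b` in one order and `a` in the other.
Both uses of linearizability go through `value_eq_of_opSeg`, for runs whose operations before the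
write have all completed. -/

namespace TSO

section

variable {n : ℕ} {X D A L : Type*}

/-! ### Rounds in which a single agent moves -/

/-- The round in which no agent moves and the environment is idle. -/
def Joint.idle : Joint n X D A L := ⟨fun _ => .null, fun _ => false, fun _ => none⟩

/-- The round in which nothing happens except that the environment invokes `o` at `k`. -/
def Joint.invoke (k : Fin n) (o : Op A) : Joint n X D A L :=
  ⟨fun _ => .null, fun _ => false, Function.update (fun _ => none) k (some o)⟩

/-- The round in which only process `k` moves, performing `a`. -/
def Joint.single (k : Fin n) (a : Act X D A L) : Joint n X D A L :=
  ⟨Function.update (fun _ => .null) k a, fun _ => false, fun _ => none⟩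

/-- The round in which only the dispatcher of `k` moves. -/
def Joint.propagate (k : Fin n) : Joint n X D A L :=
  ⟨fun _ => .null, Function.update (fun _ => false) k true, fun _ => none⟩

/-- A round is a fold over all processes and then over all dispatchers. When only `k` and its
dispatcher move, this collapses each fold to the one contribution of `k`. -/
theorem foldl_eq_of_fixed {ι S : Type*} [DecidableEq ι] (f : S → ι → S) (k : ι)
    (hf : ∀ σ i, i ≠ k → f σ i = σ) :
    ∀ (l : List ι), l.Nodup → ∀ σ, l.foldl f σ = if k ∈ l then f σ k else σ
  | [], _, σ => by simp
  | i :: l, hl, σ => by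
    rw [List.nodup_cons] at hl
    rw [List.foldl_cons, foldl_eq_of_fixed f k hf l hl.2]
    by_cases h : i = k
    · subst h; simp [hl.1]
    · rw [hf σ i h]
      have : k ≠ i := fun h' => h h'.symm
      simp [this]

theorem foldl_finRange_eq {S : Type*} (f : S → Fin n → S) (k : Fin n)
    (hf : ∀ σ i, i ≠ k → f σ i = σ) (σ : S) : (List.finRange n).foldl f σ = f σ k := by
  rw [foldl_eq_of_fixed f k hf _ (List.nodup_finRange n)]
  simp

theorem foldl_eq_self {ι S : Type*} (f : S → ι → S) (hf : ∀ σ i, f σ i = σ) (l : List ι) (σ : S) :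
    l.foldl f σ = σ := by
  induction l with
  | nil => rfl
  | cons i l ih => rw [List.foldl_cons, hf, ih]

theorem foldl_invariant {ι S : Type*} (f : S → ι → S) (P : S → Prop)
    (hf : ∀ σ i, P σ → P (f σ i)) (l : List ι) (σ : S) (h : P σ) : P (l.foldl f σ) := by
  induction l generalizing σ with
  | nil => exact h
  | cons i l ih => exact ih _ (hf _ _ h)

theorem pending_append_singleton (l : Local X D A L) (ev : Event X D A L) :
    pending (l ++ [ev]) = ev.updPending (pending l) := by
  simp [pending]

theorem pending_append_invoke (l : Local X D A L) (o : Op A) :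
    pending (l ++ [.invoke o]) = some o := pending_append_singleton _ _

variable [DecidableEq X]

@[simp] theorem actEffect_null (σ : MemState n X D) (i : Fin n) :
    actEffect σ i (.null : Act X D A L) = σ := rfl

@[simp] theorem record_null (σ : MemState n X D) (i : Fin n) :
    record σ i (.null : Act X D A L) = [] := rfl

/-- The TSO state after a round in which only `k` and its dispatcher move. -/
theorem next_tso_of_solo (g : Global n X D A L) (a : Joint n X D A L) (k : Fin n)
    (hp : ∀ i, i ≠ k → a.proc i = .null) (hd : ∀ i, i ≠ k → a.disp i = false) :
    (next g a).tso = if a.disp k then propEffect (actEffect g.tso k (a.proc k)) k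
      else actEffect g.tso k (a.proc k) := by
  unfold next
  dsimp only
  rw [foldl_finRange_eq (fun σ i => if a.disp i then propEffect σ i else σ) k
      (fun σ i hi => by simp [hd i hi]),
    foldl_finRange_eq (fun σ i => actEffect σ i (a.proc i)) k (fun σ i hi => by simp [hp i hi])]

/-- The TSO state after a round in which no agent moves. -/
theorem next_tso_of_null (g : Global n X D A L) (a : Joint n X D A L)
    (hp : ∀ i, a.proc i = .null) (hd : ∀ i, a.disp i = false) : (next g a).tso = g.tso := by
  unfold next
  dsimp only
  rw [foldl_eq_self (fun σ i => if a.disp i then propEffect σ i else σ) (fun σ i => by simp [hd i]),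
    foldl_eq_self (fun σ i => actEffect σ i (a.proc i)) (fun σ i => by simp [hp i])]

theorem next_loc (g : Global n X D A L) (a : Joint n X D A L) (k : Fin n) :
    (next g a).loc k = g.loc k ++ record g.tso k (a.proc k) ++
      ((a.env k).map Event.invoke).toList := rfl

theorem next_idle (g : Global n X D A L) : next g Joint.idle = g := by
  rw [show next g Joint.idle = ⟨(next g Joint.idle).tso, (next g Joint.idle).loc⟩ from rfl,
    next_tso_of_null g Joint.idle (fun _ => rfl) (fun _ => rfl)]
  congr 1
  funext i
  simp [next_loc, Joint.idle]

theorem next_invoke (g : Global n X D A L) (k : Fin n) (o : Op A) :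
    next g (Joint.invoke k o) = ⟨g.tso, Function.update g.loc k (g.loc k ++ [.invoke o])⟩ := by
  rw [show next g (Joint.invoke k o) = ⟨(next g (Joint.invoke k o)).tso,
      (next g (Joint.invoke k o)).loc⟩ from rfl,
    next_tso_of_null g (Joint.invoke k o) (fun _ => rfl) (fun _ => rfl)]
  congr 1
  funext i
  by_cases h : i = k
  · subst h; simp [next_loc, Joint.invoke]
  · simp [next_loc, Joint.invoke, h]

theorem next_single (g : Global n X D A L) (k : Fin n) (a : Act X D A L) :
    next g (Joint.single k a) =
      ⟨actEffect g.tso k a, Function.update g.loc k (g.loc k ++ record g.tso k a)⟩ := by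
  have h := next_tso_of_solo g (Joint.single k a) k
    (fun i hi => by simp [Joint.single, hi]) (fun i hi => rfl)
  rw [show next g (Joint.single k a) = ⟨(next g (Joint.single k a)).tso,
    (next g (Joint.single k a)).loc⟩ from rfl, h]
  simp only [Joint.single, Bool.false_eq_true, if_false, Function.update_self, Global.mk.injEq,
    true_and]
  funext i
  rw [next_loc]
  by_cases h : i = k
  · subst h; simp
  · simp [h]

/-- A joint action in which at most one agent accesses memory has no conflicts. -/
theorem not_conflict_of_accesses {σ : MemState n X D} {a : Joint n X D A L} (c : Agent n)
    (h : ∀ b x, Accesses σ a b x → b = c) (b b' : Agent n) (hb : b ≠ b') : ¬ Conflict σ a b b' := by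
  rintro ⟨x, h1, h2, -⟩
  exact hb ((h b x h1).trans (h b' x h2).symm)

theorem not_accesses_of_null {σ : MemState n X D} {a : Joint n X D A L}
    (hp : ∀ i, a.proc i = .null) (hd : ∀ i, a.disp i = false) (b : Agent n) (x : X) :
    ¬ Accesses σ a b x := by
  cases b <;> simp [Accesses, ReadsMem, Propagates, Rmws, hp, hd]

theorem jointEnabled_idle (g : Global n X D A L) : JointEnabled g Joint.idle where
  proc i := trivial
  disp i h := by simp [Joint.idle] at h
  env i h := by simp [Joint.idle] at h
  no_conflict b c _ := by
    rintro ⟨x, h1, -⟩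
    exact not_accesses_of_null (fun _ => rfl) (fun _ => rfl) b x h1

theorem jointEnabled_invoke (g : Global n X D A L) (k : Fin n) (o : Op A)
    (h : pending (g.loc k) = none) : JointEnabled g (Joint.invoke k o) where
  proc i := trivial
  disp i h := by simp [Joint.invoke] at h
  env i hi := by
    by_cases hk : i = k
    · subst hk; simpa [Joint.invoke] using h
    · simp [Joint.invoke, hk] at hi
  no_conflict b c _ := by
    rintro ⟨x, h1, -⟩
    exact not_accesses_of_null (fun _ => rfl) (fun _ => rfl) b x h1

theorem jointEnabled_single (g : Global n X D A L) (k : Fin n) (a : Act X D A L)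
    (h : ActEnabled g k a) : JointEnabled g (Joint.single k a) where
  proc i := by
    by_cases hk : i = k
    · subst hk; simpa [Joint.single] using h
    · simp [Joint.single, hk, ActEnabled]
  disp i h := by simp [Joint.single] at h
  env i h := by simp [Joint.single] at h
  no_conflict := not_conflict_of_accesses (.proc k) fun b x hb => by
    cases b with
    | disp i => simp [Accesses, ReadsMem, Propagates, Rmws, Joint.single] at hb
    | proc i =>
      by_contra hk
      have hk : i ≠ k := fun h => hk (by rw [h])
      simp [Accesses, ReadsMem, Propagates, Rmws, Joint.single, hk] at hb

theorem jointEnabled_propagate (g : Global n X D A L) (k : Fin n) (h : g.tso.buf k ≠ []) :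
    JointEnabled g (Joint.propagate k) where
  proc i := trivial
  disp i hi := by
    by_cases hk : i = k
    · subst hk; exact h
    · simp [Joint.propagate, hk] at hi
  env i h := by simp [Joint.propagate] at h
  no_conflict := not_conflict_of_accesses (.disp k) fun b x hb => by
    cases b with
    | proc i => simp [Accesses, ReadsMem, Propagates, Rmws, Joint.propagate] at hb
    | disp i =>
      by_contra hk
      have hk : i ≠ k := fun h => hk (by rw [h])
      simp [Accesses, ReadsMem, Propagates, Rmws, Joint.propagate, hk] at hb

theorem actEffect_buf_ne_nil {σ : MemState n X D} {i : Fin n} (k : Fin n) (a : Act X D A L)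
    (h : σ.buf i ≠ []) : (actEffect σ k a).buf i ≠ [] := by
  cases a with
  | write x v =>
    by_cases hk : i = k
    · subst hk; simp [actEffect]
    · simpa [actEffect, hk] using h
  | _ => exact h

theorem propEffect_buf_of_ne {σ : MemState n X D} {i k : Fin n} (hk : i ≠ k) :
    (propEffect σ k).buf i = σ.buf i := by
  unfold propEffect
  split
  · rfl
  · simp [hk]

/-- Writes only lengthen buffers, and only the own dispatcher shortens one. This keeps a propagation
enabled until it is performed, as dispatcher fairness requires. -/
theorem next_buf_ne_nil {g : Global n X D A L} {a : Joint n X D A L} {i : Fin n}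
    (h : g.tso.buf i ≠ []) (ha : a.disp i = false) : (next g a).tso.buf i ≠ [] := by
  unfold next
  dsimp only
  refine foldl_invariant _ (fun σ : MemState n X D => σ.buf i ≠ []) (fun σ k hσ => ?_) _ _
    (foldl_invariant _ (fun σ : MemState n X D => σ.buf i ≠ [])
      (fun σ k hσ => actEffect_buf_ne_nil _ _ hσ) _ _ h)
  by_cases hk : i = k
  · subst hk; simpa [ha] using hσ
  · split
    · rw [propEffect_buf_of_ne hk]; exact hσ
    · exact hσ

/-! ### Views -/

theorem bufLookup_append_singleton (β : List (X × D)) (y : X) (v : D) (x : X) :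
    bufLookup (β ++ [(y, v)]) x = if y = x then some v else bufLookup β x := by
  unfold bufLookup
  rw [List.filter_append]
  by_cases h : y = x <;> simp [h]

/-- The oldest item counts only if no later item is for the same variable. -/
theorem bufLookup_cons (β : List (X × D)) (y : X) (v : D) (x : X) :
    bufLookup ((y, v) :: β) x = (bufLookup β x).or (if y = x then some v else none) := by
  unfold bufLookup
  by_cases h : y = x
  · simp only [List.filter_cons, h, decide_true, if_true, List.getLast?_cons]
    cases (List.filter (fun p : X × D => decide (p.1 = x)) β).getLast? <;> simp
  · simp [h]

/-- The effect of an action of a process on its own view of memory. -/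
def viewEffect (V : X → D) : Act X D A L → X → D
  | .write x v => Function.update V x v
  | _ => V

/-- The record of an action of a process with view `V`. -/
def viewRecord (V : X → D) : Act X D A L → Local X D A L
  | .null => []
  | .read x => [.read x (V x)]
  | .write x v => [.write x v]
  | .fence => [.fence]
  | .rmw x exp new => [.rmw x exp new]
  | .internal l => [.internal l]
  | .ret p => [.ret p]

/-- The item that an action appends to the buffer. -/
def Act.item : Act X D A L → List (X × D)
  | .write x v => [(x, v)]
  | _ => []

theorem record_eq_viewRecord (σ : MemState n X D) (k : Fin n) (a : Act X D A L) :
    record σ k a = viewRecord (readVal σ k) a := by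
  cases a <;> rfl

/-- If a later item for the same variable is buffered, that item hides both the propagated one and
memory. If not, memory receives exactly the value that the buffer supplied. This is why propagations
can be suppressed without their owner noticing. -/
theorem readVal_propEffect (σ : MemState n X D) (k : Fin n) :
    readVal (propEffect σ k) k = readVal σ k := by
  funext x
  unfold propEffect
  split
  · rfl
  · next y v β h =>
    simp only [readVal, h, Function.update_self, bufLookup_cons]
    cases bufLookup β x with
    | some w => simp
    | none =>
      by_cases hx : y = x
      · subst hx; simp
      · have : x ≠ y := fun h => hx h.symm
        simp [hx, this]

/-- RMWs must be excluded, because they change memory while `viewEffect` ignores them. -/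
theorem readVal_actEffect (σ : MemState n X D) (k : Fin n) (a : Act X D A L) (ha : ¬ a.IsSync) :
    readVal (actEffect σ k a) k = viewEffect (readVal σ k) a := by
  cases a with
  | write y v =>
    funext x
    simp only [readVal, actEffect, viewEffect, Function.update_self, bufLookup_append_singleton]
    by_cases hx : y = x
    · subst hx; simp
    · have : x ≠ y := fun h => hx h.symm
      simp [hx, this, readVal]
  | rmw => exact absurd trivial ha
  | _ => rfl

theorem actEffect_eq_item (σ : MemState n X D) (k : Fin n) (a : Act X D A L) (ha : ¬ a.IsSync) :
    actEffect σ k a = ⟨σ.mem, Function.update σ.buf k (σ.buf k ++ a.item)⟩ := by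
  cases a with
  | rmw => exact absurd trivial ha
  | _ => simp [actEffect, Act.item]

/-! ### Pending operations -/

theorem pending_append_record (l : Local X D A L) (σ : MemState n X D) (k : Fin n)
    (a : Act X D A L) (ha : ∀ p, a ≠ .ret p) : pending (l ++ record σ k a) = pending l := by
  cases a with
  | null => simp
  | ret p => exact absurd rfl (ha p)
  | _ => exact pending_append_singleton _ _

theorem pending_append_record_ret (l : Local X D A L) (σ : MemState n X D) (k : Fin n)
    (p : Resp A) : pending (l ++ record σ k (.ret p : Act X D A L)) = none :=
  pending_append_singleton _ _

end

section

variable {n : ℕ} {X D A L : Type*}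

/-! ### Segments of runs -/

/-- The run that follows `r` until time `T` and `q` afterwards. -/
def splice (r : Run n X D A L) (T : ℕ) (q : Run n X D A L) : Run n X D A L where
  state t := if t < T then r.state t else q.state (t - T)
  act t := if t < T then r.act t else q.act (t - T)

theorem splice_act_of_lt {r q : Run n X D A L} {T t : ℕ} (h : t < T) :
    (splice r T q).act t = r.act t := if_pos h

@[simp] theorem splice_act_add (r q : Run n X D A L) (T u : ℕ) :
    (splice r T q).act (T + u) = q.act u := by
  simp [splice]

@[simp] theorem splice_state_add (r q : Run n X D A L) (T u : ℕ) :
    (splice r T q).state (T + u) = q.state u := by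
  simp [splice]

theorem splice_state_of_le {r q : Run n X D A L} {T t : ℕ} (hq : q.state 0 = r.state T)
    (h : t ≤ T) : (splice r T q).state t = r.state t := by
  rcases h.lt_or_eq with h | rfl
  · exact if_pos h
  · simpa [hq] using splice_state_add r q t 0

theorem EndsAt.lt {r : Run n X D A L} {α : Fin n × ℕ} {e : ℕ} {p : Resp A}
    (h : EndsAt r α e p) : α.2 + 1 < e := by
  obtain ⟨t, rfl, h1, -⟩ := h
  omega

theorem EndsAt.congr {r r' : Run n X D A L} {α : Fin n × ℕ} {e : ℕ} {p : Resp A}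
    (h : EndsAt r α e p) (hr : ∀ t < e, r'.act t = r.act t) : EndsAt r' α e p := by
  obtain ⟨t, rfl, h1, h2, h3⟩ := h
  refine ⟨t, rfl, h1, by rw [hr t (by omega), h2], fun u hu hut q => ?_⟩
  rw [hr u (by omega)]
  exact h3 u hu hut q

theorem EndsAt.unique {r : Run n X D A L} {α : Fin n × ℕ} {e e' : ℕ} {p p' : Resp A}
    (h : EndsAt r α e p) (h' : EndsAt r α e' p') : e = e' := by
  obtain ⟨t, rfl, h1, h2, h3⟩ := h
  obtain ⟨t', rfl, h1', h2', h3'⟩ := h'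
  rcases lt_trichotomy t t' with h | h | h
  · exact absurd h2 (h3' t h1 h p)
  · rw [h]
  · exact absurd h2' (h3 t' h1' h p')

theorem EndsAt.splice_add {q : Run n X D A L} {k : Fin n} {s e : ℕ} {p : Resp A}
    (h : EndsAt q (k, s) e p) (r : Run n X D A L) (T : ℕ) :
    EndsAt (splice r T q) (k, T + s) (T + e) p := by
  obtain ⟨t, rfl, h1, h2, h3⟩ := h
  dsimp only at h1 h2 h3
  refine ⟨T + t, by omega, by dsimp only; omega, by rw [splice_act_add]; exact h2,
    fun u hu hut p' => ?_⟩
  dsimp only at hu hut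
  obtain ⟨v, rfl⟩ : ∃ v, u = T + v := ⟨u - T, by omega⟩
  rw [splice_act_add]
  exact h3 v (by omega) (by omega) p'

/-- Every operation invoked before time `T` completes by time `T`. -/
def Quiet (r : Run n X D A L) (T : ℕ) : Prop :=
  ∀ k t o, t < T → Invoked r (k, t) o → ∃ e p, EndsAt r (k, t) e p ∧ e ≤ T

/-- If `o` is a write, then no write of the same value is invoked before time `T`. -/
def Fresh (o : Op A) (r : Run n X D A L) (T : ℕ) : Prop :=
  ∀ v, o = .write v → ∀ t < T, ∀ k, ¬ Invoked r (k, t) (.write v)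

/-- In a fair execution of a linearizable implementation, a read that follows a write without
concurrent operations returns the value written. -/
theorem value_eq_of_linearizableRun {v₀ : A} {r : Run n X D A L} (hlin : LinearizableRun v₀ r)
    {α β : Fin n × ℕ} {w v : A} {e e' : ℕ} {p : Resp A} (hα : Invoked r α (.write w))
    (hαe : EndsAt r α e p) (hβ : Invoked r β .read) (hβe : EndsAt r β e' (.value v))
    (hαβ : Precedes r α β)
    (hother : ∀ γ o, Invoked r γ o → γ ≠ α → γ ≠ β → Precedes r γ α) : v = w := by
  obtain ⟨C, pos, h1, h2, h3, h4, h5⟩ := hlin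
  have hαC := h2 α _ _ _ hα hαe
  have hβC := h2 β _ _ _ hβ hβe
  have hlt := h4 α hαC β hβC hαβ
  rcases h5 β e' v hβ hβe with ⟨γ, hγC, hγ, h6, h7⟩ | ⟨-, h6⟩
  -- The write `γ` that is read from is not positioned before `α`. As every operation other than `α`
  -- and the read precedes `α`, it must be `α` itself.
  · have hle := h7 α hαC w hα hlt
    by_cases hγα : γ = α
    · subst hγα
      simp only [Invoked] at hγ hα
      rw [hγ] at hα
      simpa using hα
    · by_cases hγβ : γ = β
      · subst hγβ; exact absurd h6 (lt_irrefl _)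
      · have := h4 γ hγC α hαC (hother γ _ hγ hγα hγβ)
        omega
  · exact absurd hlt (h6 α hαC w hα)

variable [DecidableEq X]

/-- The first `M` rounds of `r` are rounds permitted by `I`. -/
structure Seg (I : Implementation n X D A L) (r : Run n X D A L) (M : ℕ) : Prop where
  enabled : ∀ t < M, JointEnabled (r.state t) (r.act t)
  step : ∀ t < M, r.state (t + 1) = next (r.state t) (r.act t)
  follows : ∀ t < M, ∀ i, (r.act t).proc i ≠ .null →
    (r.act t).proc i ∈ I.protocol i ((r.state t).loc i)

/-- The first `T` rounds of `r` are the beginning of an execution of `I`. -/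
structure InitSeg (I : Implementation n X D A L) (r : Run n X D A L) (T : ℕ) : Prop
    extends Seg I r T where
  mem_zero : (r.state 0).tso.mem ∈ I.initMem
  buf_zero : ∀ i, (r.state 0).tso.buf i = []
  loc_zero : ∀ i, (r.state 0).loc i = []
  write_once : ∀ v t t' i i', t < T → t' < T → (r.act t).env i = some (.write v) →
    (r.act t').env i' = some (.write v) → t = t' ∧ i = i'

variable {I : Implementation n X D A L}

theorem IsExecution.initSeg {r : Run n X D A L} (h : IsExecution I r) (T : ℕ) : InitSeg I r T where
  enabled t _ := h.enabled t
  step t _ := h.step t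
  follows t _ := h.follows t
  mem_zero := h.mem_zero
  buf_zero := h.buf_zero
  loc_zero := h.loc_zero
  write_once v t t' i i' _ _ := h.write_once v t t' i i'

/-- Each condition on an execution concerns at most two rounds, so it can be checked on initial
segments. -/
theorem isExecution_of_initSeg {r : Run n X D A L} (h : ∀ T, InitSeg I r T) : IsExecution I r where
  enabled t := (h (t + 1)).enabled t (by omega)
  step t := (h (t + 1)).step t (by omega)
  follows t := (h (t + 1)).follows t (by omega)
  mem_zero := (h 0).mem_zero
  buf_zero := (h 0).buf_zero
  loc_zero := (h 0).loc_zero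
  write_once v t t' i i' := (h (t + t' + 1)).write_once v t t' i i' (by omega) (by omega)

theorem Seg.mono {r : Run n X D A L} {M M' : ℕ} (h : Seg I r M) (hM : M' ≤ M) : Seg I r M' where
  enabled t ht := h.enabled t (by omega)
  step t ht := h.step t (by omega)
  follows t ht := h.follows t (by omega)

theorem InitSeg.mono {r : Run n X D A L} {M M' : ℕ} (h : InitSeg I r M) (hM : M' ≤ M) :
    InitSeg I r M' where
  toSeg := h.toSeg.mono hM
  mem_zero := h.mem_zero
  buf_zero := h.buf_zero
  loc_zero := h.loc_zero
  write_once v t t' i i' ht ht' := h.write_once v t t' i i' (by omega) (by omega)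

theorem Seg.append {r q : Run n X D A L} {T M : ℕ} (hr : Seg I r T) (hq : Seg I q M)
    (h0 : q.state 0 = r.state T) : Seg I (splice r T q) (T + M) := by
  have key : ∀ t < T + M, JointEnabled ((splice r T q).state t) ((splice r T q).act t) ∧
      (splice r T q).state (t + 1) = next ((splice r T q).state t) ((splice r T q).act t) ∧
      ∀ i, ((splice r T q).act t).proc i ≠ .null →
        ((splice r T q).act t).proc i ∈ I.protocol i (((splice r T q).state t).loc i) := by
    intro t ht
    rcases lt_or_ge t T with h | h
    · rw [splice_state_of_le h0 h.le, splice_state_of_le h0 (show t + 1 ≤ T from h),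
        splice_act_of_lt h]
      exact ⟨hr.enabled t h, hr.step t h, hr.follows t h⟩
    · obtain ⟨u, rfl⟩ := Nat.exists_eq_add_of_le h
      rw [add_assoc, splice_state_add, splice_state_add, splice_act_add]
      exact ⟨hq.enabled u (by omega), hq.step u (by omega), hq.follows u (by omega)⟩
  exact ⟨fun t ht => (key t ht).1, fun t ht => (key t ht).2.1, fun t ht => (key t ht).2.2⟩

/-- Appending a segment in which at most one operation is invoked, which is not a write of a value
written before. -/
theorem InitSeg.append {r q : Run n X D A L} {T M : ℕ} (hr : InitSeg I r T) (hq : Seg I q M)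
    (h0 : q.state 0 = r.state T) {o : Op A} {k : Fin n} {s : ℕ} (hf : Fresh o r T)
    (hinv : ∀ t < M, ∀ i o', (q.act t).env i = some o' → i = k ∧ t = s ∧ o' = o) :
    InitSeg I (splice r T q) (T + M) where
  toSeg := hr.toSeg.append hq h0
  mem_zero := by rw [splice_state_of_le h0 (Nat.zero_le _)]; exact hr.mem_zero
  buf_zero := by rw [splice_state_of_le h0 (Nat.zero_le _)]; exact hr.buf_zero
  loc_zero := by rw [splice_state_of_le h0 (Nat.zero_le _)]; exact hr.loc_zero
  write_once v t t' i i' ht ht' h h' := by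
    rcases lt_or_ge t T with h1 | h1 <;> rcases lt_or_ge t' T with h2 | h2
    · rw [splice_act_of_lt h1] at h
      rw [splice_act_of_lt h2] at h'
      exact hr.write_once v t t' i i' h1 h2 h h'
    · obtain ⟨u, rfl⟩ := Nat.exists_eq_add_of_le h2
      rw [splice_act_of_lt h1] at h
      rw [splice_act_add] at h'
      exact absurd h (hf v (hinv u (by omega) _ _ h').2.2.symm t h1 i)
    · obtain ⟨u, rfl⟩ := Nat.exists_eq_add_of_le h1
      rw [splice_act_of_lt h2] at h'
      rw [splice_act_add] at h
      exact absurd h' (hf v (hinv u (by omega) _ _ h).2.2.symm t' h2 i')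
    · obtain ⟨u, rfl⟩ := Nat.exists_eq_add_of_le h1
      obtain ⟨u', rfl⟩ := Nat.exists_eq_add_of_le h2
      rw [splice_act_add] at h h'
      obtain ⟨rfl, rfl, -⟩ := hinv u (by omega) _ _ h
      obtain ⟨rfl, rfl, -⟩ := hinv u' (by omega) _ _ h'
      exact ⟨rfl, rfl⟩

/-- A pending operation was invoked and has not returned since. -/
theorem exists_invoked_of_pending {r : Run n X D A L} {T : ℕ} (hr : InitSeg I r T) {k : Fin n}
    {o : Op A} (h : pending ((r.state T).loc k) = some o) :
    ∃ t < T, Invoked r (k, t) o ∧ ∀ u, t < u → u < T → ∀ p, (r.act u).proc k ≠ .ret p := by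
  induction T with
  | zero => simp [hr.loc_zero, pending] at h
  | succ T ih =>
    rw [hr.step T (by omega), next_loc] at h
    cases he : (r.act T).env k with
    | some o' =>
      simp only [he, Option.map_some, Option.toList_some, pending_append_invoke,
        Option.some.injEq] at h
      exact ⟨T, by omega, by rw [← h]; exact he, fun u h1 h2 => by omega⟩
    | none =>
      simp only [he, Option.map_none, Option.toList_none, List.append_nil] at h
      by_cases hret : ∃ p, (r.act T).proc k = .ret p
      · obtain ⟨p, hp⟩ := hret
        rw [hp, pending_append_record_ret] at h
        simp at h
      · push Not at hret
        rw [pending_append_record _ _ _ _ hret] at h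
        obtain ⟨t, ht, h1, h2⟩ := ih (hr.mono (by omega)) h
        refine ⟨t, by omega, h1, fun u hu hu' => ?_⟩
        rcases Nat.lt_succ_iff_lt_or_eq.1 hu' with h3 | rfl
        · exact h2 u hu h3
        · exact hret

theorem Quiet.pending_eq_none {r : Run n X D A L} {T : ℕ} (hQ : Quiet r T) (hr : InitSeg I r T)
    (k : Fin n) : pending ((r.state T).loc k) = none := by
  by_contra h
  obtain ⟨o, ho⟩ := Option.ne_none_iff_exists'.1 h
  obtain ⟨t, ht, h1, h2⟩ := exists_invoked_of_pending hr ho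
  obtain ⟨e, p, ⟨u, rfl, h3, h4, -⟩, h5⟩ := hQ k t o ht h1
  exact h2 u h3 (by omega) p h4

/-! ### Operations performed one after the other -/

/-- In its first `M` rounds `q` starts in the state `g`, and consists of an operation `o` of `k`,
invoked in the second round, and completing with response `p` in the last. -/
structure OpSeg (I : Implementation n X D A L) (g : Global n X D A L) (k : Fin n) (o : Op A)
    (p : Resp A) (M : ℕ) (q : Run n X D A L) : Prop where
  start : q.state 0 = g
  seg : Seg I q M
  invoked : Invoked q (k, 1) o
  only : ∀ t < M, ∀ i o', Invoked q (i, t) o' → i = k ∧ t = 1 ∧ o' = o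
  ends : EndsAt q (k, 1) M p

section

variable {r q : Run n X D A L} {T M : ℕ} {k : Fin n} {o : Op A} {p : Resp A}

theorem OpSeg.initSeg (hq : OpSeg I (r.state T) k o p M q) (hr : InitSeg I r T)
    (hf : Fresh o r T) : InitSeg I (splice r T q) (T + M) :=
  hr.append hq.seg hq.start hf hq.only

theorem OpSeg.fresh (hq : OpSeg I (r.state T) k o p M q) {o' : Op A} (hf : Fresh o' r T)
    (ho : ∀ v, o' = .write v → o ≠ .write v) : Fresh o' (splice r T q) (T + M) := by
  rintro v rfl t ht i hi
  rcases lt_or_ge t T with h | h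
  · exact hf v rfl t h i (by simpa [Invoked, splice_act_of_lt h] using hi)
  · obtain ⟨u, rfl⟩ := Nat.exists_eq_add_of_le h
    simp only [Invoked, splice_act_add] at hi
    exact ho v rfl (hq.only u (by omega) _ _ hi).2.2.symm

theorem OpSeg.quiet (hq : OpSeg I (r.state T) k o p M q) (hQ : Quiet r T) :
    Quiet (splice r T q) (T + M) := by
  intro i t o' ht hi
  rcases lt_or_ge t T with h | h
  · obtain ⟨e, p', h1, h2⟩ := hQ i t o' h (by simpa [Invoked, splice_act_of_lt h] using hi)
    exact ⟨e, p', h1.congr fun u hu => splice_act_of_lt (by omega), by omega⟩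
  · obtain ⟨u, rfl⟩ := Nat.exists_eq_add_of_le h
    simp only [Invoked, splice_act_add] at hi
    obtain ⟨rfl, rfl, -⟩ := hq.only u (by omega) _ _ hi
    exact ⟨T + M, p, hq.ends.splice_add r T, le_rfl⟩

end


end

section

variable {n : ℕ} {X D A L : Type*} {I : Implementation n X D A L}

/-! ### Rounds chosen by a scheduler -/

open Classical in
/-- A round in which only the given agent moves, if it can. -/
noncomputable def agentJoint (I : Implementation n X D A L) (g : Global n X D A L) :
    Agent n → Joint n X D A L
  | .proc k => if h : CanMove I g k then Joint.single k h.choose else Joint.idle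
  | .disp k => if g.tso.buf k = [] then Joint.idle else Joint.propagate k

theorem agentJoint_proc_ne_null {g : Global n X D A L} {k : Fin n} (h : CanMove I g k) :
    (agentJoint I g (.proc k)).proc k ≠ .null := by
  simpa [agentJoint, h, Joint.single] using h.choose_spec.2.1

theorem agentJoint_disp {g : Global n X D A L} {k : Fin n} (h : g.tso.buf k ≠ []) :
    (agentJoint I g (.disp k)).disp k = true := by
  simp [agentJoint, h, Joint.propagate]

theorem agentJoint_env (g : Global n X D A L) (b : Agent n) (i : Fin n) :
    (agentJoint I g b).env i = none := by
  cases b <;> simp only [agentJoint] <;> split <;> rfl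

theorem agentJoint_proc_of_ne (g : Global n X D A L) {b : Agent n} {i : Fin n}
    (h : b ≠ .proc i) : (agentJoint I g b).proc i = .null := by
  cases b with
  | proc k =>
    have hk : i ≠ k := fun hk => h (by rw [hk])
    simp only [agentJoint]
    split
    · simp [Joint.single, hk]
    · rfl
  | disp k => simp only [agentJoint]; split <;> rfl

theorem agentJoint_disp_of_ne (g : Global n X D A L) {b : Agent n} {i : Fin n}
    (h : b ≠ .disp i) : (agentJoint I g b).disp i = false := by
  cases b with
  | disp k =>
    have hk : i ≠ k := fun hk => h (by rw [hk])
    simp only [agentJoint]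
    split
    · rfl
    · simp [Joint.propagate, hk]
  | proc k => simp only [agentJoint]; split <;> rfl

theorem agentJoint_follows (g : Global n X D A L) (b : Agent n) (i : Fin n)
    (h : (agentJoint I g b).proc i ≠ .null) :
    (agentJoint I g b).proc i ∈ I.protocol i (g.loc i) := by
  by_cases hb : b = .proc i
  · subst hb
    by_cases hc : CanMove I g i
    · simpa [agentJoint, hc, Joint.single] using hc.choose_spec.1
    · simp [agentJoint, hc, Joint.idle] at h
  · exact absurd (agentJoint_proc_of_ne g hb) h

/-- The agent with index `c` is scheduled in each round `Nat.pair c T'`. These rounds are unbounded,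
since `Nat.pair c T'` is at least `T'`. -/
theorem fairProc_of_tail {r : Run n X D A L} {T : ℕ} {f : ℕ → Agent n} {k : Fin n} {c : ℕ}
    (h : ∀ u, r.act (T + u) = agentJoint I (r.state (T + u)) (f u.unpair.1))
    (hc : f c = .proc k) : FairProc I r k := by
  intro T' hT'
  have hle := Nat.right_le_pair c T'
  refine ⟨T + Nat.pair c T', by omega, ?_⟩
  rw [h, Nat.unpair_pair, hc]
  exact agentJoint_proc_ne_null (hT' _ (by omega))

/-- The state `g` after `k` has appended `w` to its buffer and has come to the local state `l`. -/
def Global.frozen (g : Global n X D A L) (k : Fin n) (w : List (X × D)) (l : Local X D A L) :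
    Global n X D A L :=
  ⟨⟨g.tso.mem, Function.update g.tso.buf k (g.tso.buf k ++ w)⟩, Function.update g.loc k l⟩

/-- Unpropagated operations of different processes touch disjoint components of the state, so their
order leaves no mark. -/
theorem Global.frozen_comm (g : Global n X D A L) {i j : Fin n} (hij : i ≠ j)
    (w w' : List (X × D)) (l l' : Local X D A L) :
    (g.frozen i w l).frozen j w' l' = (g.frozen j w' l').frozen i w l := by
  simp only [Global.frozen, Function.update_of_ne hij, Function.update_of_ne hij.symm]
  rw [Function.update_comm hij, Function.update_comm hij]

theorem loc_frozen_of_ne (g : Global n X D A L) {i k : Fin n} (h : i ≠ k) (w : List (X × D))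
    (l : Local X D A L) : (g.frozen k w l).loc i = g.loc i := by
  simp [Global.frozen, h]

variable [DecidableEq X]

/-! ### Runs generated by a controller -/

/-- The states reached from `g` when the joint actions are chosen by `c`. -/
def genState (g : Global n X D A L) (c : ℕ → Global n X D A L → Joint n X D A L) :
    ℕ → Global n X D A L
  | 0 => g
  | t + 1 => next (genState g c t) (c t (genState g c t))

/-- The run from `g` in which the joint actions are chosen by `c`. -/
def gen (g : Global n X D A L) (c : ℕ → Global n X D A L → Joint n X D A L) : Run n X D A L where
  state := genState g c
  act t := c t (genState g c t)

/-! ### Traces without fences and read-modify-writes -/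

/-- The actions `a 0, …, a (m - 1)` are permitted for process `k` and are no fences or
read-modify-writes. They lead through the local states `l` and the views `V`, provided that nothing
but writes of `k` changes the view. -/
structure Trace (I : Implementation n X D A L) (k : Fin n) (V : ℕ → X → D) (l : ℕ → Local X D A L)
    (a : ℕ → Act X D A L) (m : ℕ) : Prop where
  not_isSync : ∀ u < m, ¬ (a u).IsSync
  follows : ∀ u < m, a u ≠ .null → a u ∈ I.protocol k (l u)
  ret : ∀ u < m, ∀ p, a u = .ret p → ∃ o, pending (l u) = some o ∧ p.Fits o
  loc : ∀ u < m, l (u + 1) = l u ++ viewRecord (V u) (a u)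
  view : ∀ u < m, V (u + 1) = viewEffect (V u) (a u)

/-- A segment in which only `k` and its dispatcher move gives a trace. -/
theorem trace_of_solo {q : Run n X D A L} {T m : ℕ} (k : Fin n) (hq : Seg I q (T + m))
    (hsolo : ∀ u < m, ∀ i, i ≠ k →
      (q.act (T + u)).proc i = .null ∧ (q.act (T + u)).disp i = false)
    (henv : ∀ u < m, (q.act (T + u)).env k = none)
    (hsync : ∀ u < m, ¬ ((q.act (T + u)).proc k).IsSync) :
    Trace I k (fun u => readVal (q.state (T + u)).tso k) (fun u => (q.state (T + u)).loc k)
      (fun u => (q.act (T + u)).proc k) m where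
  not_isSync := hsync
  follows u hu := hq.follows (T + u) (by omega) k
  ret u hu p hp := by
    have := (hq.enabled (T + u) (by omega)).proc k
    rwa [hp] at this
  loc u hu := by
    rw [← add_assoc, hq.step (T + u) (by omega), next_loc, henv u hu, record_eq_viewRecord]
    simp
  view u hu := by
    rw [← add_assoc, hq.step (T + u) (by omega),
      next_tso_of_solo _ _ k (fun i hi => (hsolo u hu i hi).1) (fun i hi => (hsolo u hu i hi).2),
      ← readVal_actEffect _ _ _ (hsync u hu)]
    split
    · rw [readVal_propEffect]
    · rfl

/-- The items appended to the buffer by the first `m` of the actions `a`. -/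
def items (a : ℕ → Act X D A L) : ℕ → List (X × D)
  | 0 => []
  | m + 1 => items a m ++ (a m).item

/-- The run from `g` in which `k` performs the actions `a` and no other agent moves. -/
def block (g : Global n X D A L) (k : Fin n) (a : ℕ → Act X D A L) : Run n X D A L :=
  gen g fun u _ => Joint.single k (a u)

theorem block_act (g : Global n X D A L) (k : Fin n) (a : ℕ → Act X D A L) (u : ℕ) :
    (block g k a).act u = Joint.single k (a u) := rfl

section

variable {k : Fin n} {V : ℕ → X → D} {l : ℕ → Local X D A L} {a : ℕ → Act X D A L} {m : ℕ}
  {g : Global n X D A L}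

/-- The two claims need each other: the recorded reads are those of the trace because the view is,
and the view evolves through the writes of `k` alone because nothing else moves. -/
theorem Trace.block_state (h : Trace I k V l a m) (hV : V 0 = readVal g.tso k)
    (hl : l 0 = g.loc k) {u : ℕ} (hu : u ≤ m) :
    (block g k a).state u = g.frozen k (items a u) (l u) ∧
      readVal ((block g k a).state u).tso k = V u := by
  induction u with
  | zero =>
    refine ⟨?_, hV.symm⟩
    change g = _
    simp [Global.frozen, items, hl]
  | succ u ih =>
    obtain ⟨h1, h2⟩ := ih (by omega)
    have hs : (block g k a).state (u + 1) =
        next ((block g k a).state u) (Joint.single k (a u)) := rfl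
    have hsync := h.not_isSync u (by omega)
    refine ⟨?_, ?_⟩
    · rw [hs, next_single, record_eq_viewRecord, h2, h1, actEffect_eq_item _ _ _ hsync,
        h.loc u (by omega)]
      simp [Global.frozen, items]
    · rw [hs, next_single, readVal_actEffect _ _ _ hsync, h2, h.view u (by omega)]

/-- Without fences and RMWs, enabledness of an action never depends on buffers or memory. Only
returns have a precondition, and it concerns the local state, which is that of the trace. -/
theorem Trace.block_seg (h : Trace I k V l a m) (hV : V 0 = readVal g.tso k)
    (hl : l 0 = g.loc k) : Seg I (block g k a) m where
  step t _ := rfl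
  enabled t ht := by
    refine jointEnabled_single _ _ _ ?_
    have hs := h.not_isSync t ht
    have hret := h.ret t ht
    rw [(h.block_state hV hl ht.le).1]
    cases hat : a t with
    | fence => rw [hat] at hs; exact absurd trivial hs
    | rmw => rw [hat] at hs; exact absurd trivial hs
    | ret p => simpa [ActEnabled, Global.frozen] using hret p hat
    | _ => trivial
  follows t ht i hi := by
    rw [block_act] at hi ⊢
    by_cases hk : i = k
    · subst hk
      rw [(h.block_state hV hl ht.le).1]
      simp only [Joint.single, Function.update_self, Global.frozen] at hi ⊢
      exact h.follows t ht hi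
    · simp [Joint.single, hk] at hi

/-- The run from `g` in which, after an idle round, `o` is invoked at `k`. -/
def invocation (g : Global n X D A L) (k : Fin n) (o : Op A) : Run n X D A L :=
  gen g fun u _ => if u = 0 then Joint.idle else Joint.invoke k o

theorem invocation_state_one (g : Global n X D A L) (k : Fin n) (o : Op A) :
    (invocation g k o).state 1 = g := next_idle g

theorem invocation_state_two (g : Global n X D A L) (k : Fin n) (o : Op A) :
    (invocation g k o).state 2 = ⟨g.tso, Function.update g.loc k (g.loc k ++ [.invoke o])⟩ := by
  have h : (invocation g k o).state 2 = next ((invocation g k o).state 1) (Joint.invoke k o) := rfl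
  rw [h, invocation_state_one, next_invoke]

theorem invocation_env {t : ℕ} {i : Fin n} {o o' : Op A}
    (h : ((invocation g k o).act t).env i = some o') (ht : t < 2) : i = k ∧ t = 1 ∧ o' = o := by
  obtain rfl | rfl : t = 0 ∨ t = 1 := by omega
  · exact absurd h (by simp [invocation, gen, Joint.idle])
  · by_cases hk : i = k
    · subst hk
      simp only [invocation, gen, Joint.invoke, one_ne_zero, if_false, Function.update_self,
        Option.some.injEq] at h
      exact ⟨rfl, rfl, h.symm⟩
    · simp [invocation, gen, Joint.invoke, hk] at h

theorem invocation_proc (t : ℕ) (i : Fin n) (o : Op A) :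
    ((invocation g k o).act t).proc i = .null := by
  simp only [invocation, gen]
  split <;> rfl

theorem invocation_disp (t : ℕ) (i : Fin n) (o : Op A) :
    ((invocation g k o).act t).disp i = false := by
  simp only [invocation, gen]
  split <;> rfl

theorem invocation_seg (o : Op A) (h : pending (g.loc k) = none) :
    Seg I (invocation g k o) 2 where
  step t _ := rfl
  enabled t ht := by
    obtain rfl | rfl : t = 0 ∨ t = 1 := by omega
    · exact jointEnabled_idle g
    · rw [invocation_state_one]
      exact jointEnabled_invoke g k o h
  follows t ht i hi := absurd (invocation_proc t i o) hi

/-- A trace of a complete operation can be replayed from every state with the right view and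
local state, without propagation. -/
theorem Trace.exists_opSeg {o : Op A} {p : Resp A} (h : Trace I k V l a (m + 1))
    (hV : V 0 = readVal g.tso k) (hl : l 0 = g.loc k ++ [.invoke o])
    (hpend : pending (g.loc k) = none) (hret : a m = .ret p) (hne : ∀ u < m, ∀ p', a u ≠ .ret p') :
    ∃ q, OpSeg I g k o p (2 + (m + 1)) q ∧
      q.state (2 + (m + 1)) = g.frozen k (items a (m + 1)) (l (m + 1)) := by
  set g' : Global n X D A L := ⟨g.tso, Function.update g.loc k (g.loc k ++ [.invoke o])⟩ with hg'
  have hV' : V 0 = readVal g'.tso k := hV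
  have hl' : l 0 = g'.loc k := by simp [hg', hl]
  have h0 : (block g' k a).state 0 = (invocation g k o).state 2 :=
    (invocation_state_two g k o).symm
  refine ⟨splice (invocation g k o) 2 (block g' k a), ⟨?_, ?_, ?_, ?_, ?_⟩, ?_⟩
  · rw [splice_state_of_le h0 (by omega)]; rfl
  · exact (invocation_seg o hpend).append (h.block_seg hV' hl') h0
  · rw [Invoked, splice_act_of_lt (by dsimp only; omega)]
    simp [invocation, gen, Joint.invoke]
  · intro t ht i o' hi
    rcases lt_or_ge t 2 with h2 | h2
    · rw [Invoked, splice_act_of_lt h2] at hi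
      exact invocation_env hi h2
    · obtain ⟨u, rfl⟩ := Nat.exists_eq_add_of_le h2
      simp [Invoked, block_act, Joint.single] at hi
  · refine ⟨2 + m, rfl, by dsimp only; omega, ?_, fun u hu hum p' => ?_⟩
    · simp [block_act, Joint.single, hret]
    · dsimp only at hu
      obtain ⟨v, rfl⟩ : ∃ v, u = 2 + v := ⟨u - 2, by omega⟩
      simpa [block_act, Joint.single] using hne v (by omega) p'
  · rw [splice_state_add, (h.block_state hV' hl' le_rfl).1]
    simp [Global.frozen, hg']

end

/-! ### Fair scheduling -/

theorem jointEnabled_agentJoint (g : Global n X D A L) (b : Agent n) :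
    JointEnabled g (agentJoint I g b) := by
  cases b with
  | proc k =>
    simp only [agentJoint]
    split
    · next h => exact jointEnabled_single _ _ _ h.choose_spec.2.2
    · exact jointEnabled_idle g
  | disp k =>
    simp only [agentJoint]
    split
    · exact jointEnabled_idle g
    · next h => exact jointEnabled_propagate _ _ h

/-- The run from `g` in which every agent in the range of `f` is scheduled infinitely often. -/
noncomputable def fairRun (I : Implementation n X D A L) (g : Global n X D A L) (f : ℕ → Agent n) :
    Run n X D A L :=
  gen g fun u g' => agentJoint I g' (f u.unpair.1)

theorem fairRun_act (g : Global n X D A L) (f : ℕ → Agent n) (u : ℕ) :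
    (fairRun I g f).act u = agentJoint I ((fairRun I g f).state u) (f u.unpair.1) := rfl

theorem fairRun_seg (g : Global n X D A L) (f : ℕ → Agent n) (M : ℕ) :
    Seg I (fairRun I g f) M where
  step _ _ := rfl
  enabled _ _ := jointEnabled_agentJoint _ _
  follows _ _ i h := agentJoint_follows _ _ i h

section

variable {r : Run n X D A L} {T : ℕ} {f : ℕ → Agent n} {k : Fin n} {c : ℕ}

/-- If the dispatcher stayed idle, the buffer would remain nonempty until the next round in which
this dispatcher is scheduled, and it would propagate there. -/
theorem fairDisp_of_tail
    (h : ∀ u, r.act (T + u) = agentJoint I (r.state (T + u)) (f u.unpair.1))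
    (hr : ∀ t, r.state (t + 1) = next (r.state t) (r.act t))
    (hc : f c = .disp k) : FairDisp r k := by
  intro T' hT'
  by_contra! hcon
  have hne : ∀ t, T' ≤ t → (r.state t).tso.buf k ≠ [] := by
    intro t ht
    induction t, ht using Nat.le_induction with
    | base => exact hT'
    | succ t ht ih =>
      rw [hr]
      exact next_buf_ne_nil ih (by simpa using hcon t ht)
  have hle := Nat.right_le_pair c T'
  refine hcon (T + Nat.pair c T') (by omega) ?_
  rw [h, Nat.unpair_pair, hc]
  exact agentJoint_disp (hne _ (by omega))

end

theorem exists_agent_enumeration (k : Fin n) : ∃ f : ℕ → Agent n, Function.Surjective f := by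
  have : Nonempty (Agent n) := ⟨.proc k⟩
  have : Countable (Agent n) := by
    refine Function.Injective.countable (β := Bool × Fin n)
      (f := fun b => match b with | .proc i => (true, i) | .disp i => (false, i)) ?_
    rintro (i | i) (j | j) h <;> simp_all
  exact exists_surjective_nat _

/-- The beginning of an execution can be continued, without further invocations, to a fair one. -/
theorem InitSeg.exists_fair {r : Run n X D A L} {T : ℕ} (hr : InitSeg I r T) (k : Fin n) :
    ∃ q, q.state 0 = r.state T ∧ (∀ u i, (q.act u).env i = none) ∧
      IsExecution I (splice r T q) ∧ IsFair I (splice r T q) := by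
  obtain ⟨f, hf⟩ := exists_agent_enumeration k
  set q := fairRun I (r.state T) f with hq
  have h0 : q.state 0 = r.state T := rfl
  have henv : ∀ u i, (q.act u).env i = none := fun u i => agentJoint_env _ _ i
  have hex : IsExecution I (splice r T q) := by
    refine isExecution_of_initSeg fun M => InitSeg.mono (M := T + M) ?_ (by omega)
    -- Nothing is invoked in the tail, so the operation, process and time are placeholders; a read
    -- is trivially fresh.
    refine hr.append (fairRun_seg _ _ M) h0 (o := .read) (k := k) (s := 0) ?_ ?_
    · intro v hv; simp at hv
    · intro t _ i o' hi
      rw [henv] at hi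
      simp at hi
  have htail : ∀ u, (splice r T q).act (T + u) =
      agentJoint I ((splice r T q).state (T + u)) (f u.unpair.1) := by
    intro u
    rw [splice_act_add, splice_state_add]
    rfl
  refine ⟨q, h0, henv, hex, fun i => ⟨?_, ?_⟩⟩
  · obtain ⟨c, hc⟩ := hf (.proc i)
    exact fairProc_of_tail htail hc
  · obtain ⟨c, hc⟩ := hf (.disp i)
    exact fairDisp_of_tail htail hex.step hc

/-- In an obstruction-free implementation, an operation invoked when nothing is pending completes
if only its process and its dispatcher move. -/
theorem InitSeg.exists_opSeg (hOF : ObstructionFree I) {r : Run n X D A L} {T : ℕ}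
    (hr : InitSeg I r T) {k : Fin n} (hk : pending ((r.state T).loc k) = none) {o : Op A}
    (ho : Fresh o r T) :
    ∃ q M p, OpSeg I (r.state T) k o p M q ∧ p.Fits o ∧
      q.state 2 = ⟨(r.state T).tso,
        Function.update (r.state T).loc k ((r.state T).loc k ++ [.invoke o])⟩ ∧
      ∀ u i, i ≠ k → (q.act u).proc i = .null ∧ (q.act u).disp i = false := by
  classical
  set g := r.state T with hg
  -- Only `k` and its dispatcher are ever scheduled: index `0` stands for the process, every other
  -- index for the dispatcher.
  set f : ℕ → Agent n := fun c => if c = 0 then .proc k else .disp k with hf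
  set w := fairRun I ((invocation g k o).state 2) f with hw
  set q := splice (invocation g k o) 2 w with hq
  have hw0 : w.state 0 = (invocation g k o).state 2 := rfl
  have hq0 : q.state 0 = g := by rw [hq, splice_state_of_le hw0 (by omega)]; rfl
  have hseg : ∀ M, Seg I q M := fun M =>
    Seg.mono ((invocation_seg o hk).append (fairRun_seg _ _ M) hw0) (by omega)
  have honly : ∀ t i o', Invoked q (i, t) o' → i = k ∧ t = 1 ∧ o' = o := by
    intro t i o' hi
    rcases lt_or_ge t 2 with h2 | h2
    · rw [Invoked, splice_act_of_lt h2] at hi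
      exact invocation_env hi h2
    · obtain ⟨u, rfl⟩ := Nat.exists_eq_add_of_le h2
      rw [Invoked, splice_act_add, hw, fairRun_act, agentJoint_env] at hi
      simp at hi
  have hex : IsExecution I (splice r T q) := isExecution_of_initSeg fun M =>
    InitSeg.mono (hr.append (hseg M) hq0 ho fun t _ => honly t) (by omega)
  have hsolo : ∀ u i, i ≠ k → (q.act u).proc i = .null ∧ (q.act u).disp i = false := by
    intro u i hi
    rcases lt_or_ge u 2 with h2 | h2
    · rw [hq, splice_act_of_lt h2]
      exact ⟨invocation_proc u i o, invocation_disp u i o⟩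
    · obtain ⟨u, rfl⟩ := Nat.exists_eq_add_of_le h2
      rw [hq, splice_act_add, hw, fairRun_act]
      have hi' : k ≠ i := fun h => hi h.symm
      refine ⟨agentJoint_proc_of_ne _ ?_, agentJoint_disp_of_ne _ ?_⟩ <;>
        simp only [hf] <;> split <;> simp [hi']
  have hact : ∀ u, (splice r T q).act (T + 2 + u) = w.act u := fun u => by
    rw [add_assoc, splice_act_add, hq, splice_act_add]
  have hstate : ∀ u, (splice r T q).state (T + 2 + u) = w.state u := fun u => by
    rw [add_assoc, splice_state_add, hq, splice_state_add]
  have htail : ∀ u, (splice r T q).act (T + 2 + u) =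
      agentJoint I ((splice r T q).state (T + 2 + u)) (f u.unpair.1) := fun u => by
    rw [hact, hstate]; rfl
  have hpend2 : pending ((w.state 0).loc k) = some o := by
    rw [hw0, invocation_state_two]
    simp [pending_append_invoke]
  have hex_ret : ∃ u p, (w.act u).proc k = .ret p := by
    obtain ⟨t, p, ht, h⟩ := hOF _ hex k (T + 2)
      (by rw [show T + 2 = T + 2 + 0 from rfl, hstate, hpend2]; simp)
      (fun e t ht _ i hi => by
        obtain ⟨u, rfl⟩ := Nat.exists_eq_add_of_le ht
        rw [add_assoc, splice_act_add]
        exact hsolo _ i hi)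
      (fairProc_of_tail htail (c := 0) rfl) (fairDisp_of_tail htail hex.step (c := 1) rfl)
    obtain ⟨u, rfl⟩ := Nat.exists_eq_add_of_le ht
    exact ⟨u, p, by rw [← hact]; exact h⟩
  -- Obstruction-freedom yields some return; the first one is the response to `o`, since `o` is
  -- pending until then.
  obtain ⟨p, hp⟩ := Nat.find_spec hex_ret
  have hmin : ∀ u < Nat.find hex_ret, ∀ p', (w.act u).proc k ≠ .ret p' := fun u hu p' h =>
    Nat.find_min hex_ret hu ⟨p', h⟩
  set u₀ := Nat.find hex_ret with hu₀
  have hpend : ∀ u ≤ u₀, pending ((w.state u).loc k) = some o := by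
    intro u hu
    induction u with
    | zero => exact hpend2
    | succ u ih =>
      have hstep : w.state (u + 1) = next (w.state u) (w.act u) := rfl
      have henv : (w.act u).env k = none := agentJoint_env _ _ _
      rw [hstep, next_loc, henv]
      simp only [Option.map_none, Option.toList_none, List.append_nil]
      rw [pending_append_record _ _ _ _ (hmin u (by omega))]
      exact ih (by omega)
  refine ⟨q, 2 + (u₀ + 1), p, ⟨hq0, hseg _, ?_, fun t _ => honly t, ?_⟩, ?_, ?_, hsolo⟩
  · rw [Invoked, hq, splice_act_of_lt (by dsimp only; omega)]
    simp [invocation, gen, Joint.invoke]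
  · refine ⟨2 + u₀, rfl, by dsimp only; omega, ?_, fun u hu hum p' => ?_⟩
    · rw [hq, splice_act_add]; exact hp
    · dsimp only at hu
      obtain ⟨v, rfl⟩ : ∃ v, u = 2 + v := ⟨u - 2, by omega⟩
      rw [hq, splice_act_add]
      exact hmin v (by omega) p'
  · have := ((hseg (2 + u₀ + 1)).enabled (2 + u₀) (by omega)).proc k
    rw [hq, splice_act_add, splice_state_add, hp] at this
    obtain ⟨o', h1, h2⟩ := this
    rw [hpend u₀ le_rfl] at h1
    obtain rfl : o = o' := by simpa using h1
    exact h2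
  · rw [hq, splice_state_of_le hw0 le_rfl, invocation_state_two]

/-- A read that follows a write without concurrent operations returns the value written. -/
theorem value_eq_of_opSeg {v₀ : A} (hLin : Linearizable I v₀) {r q q' : Run n X D A L}
    {T M M' : ℕ} (hr : InitSeg I r T) (hQ : Quiet r T) {k k' : Fin n} {w v : A} {p : Resp A}
    (hq : OpSeg I (r.state T) k (.write w) p M q) (hw : Fresh (.write w) r T)
    (hq' : OpSeg I (q.state M) k' .read (.value v) M' q') : v = w := by
  have hr1 := hq.initSeg hr hw
  set r₁ := splice r T q with hr₁
  have hst : r₁.state (T + M) = q.state M := splice_state_add _ _ _ _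
  rw [← hst] at hq'
  have hr2 := hq'.initSeg hr1 (fun v hv => by simp at hv)
  -- Linearizability is assumed for fair runs only, hence the continuation, which invokes nothing.
  obtain ⟨z, hz0, hzenv, hex, hfair⟩ := hr2.exists_fair k
  set R := splice (splice r₁ (T + M) q') (T + M + M') z with hR
  have hact1 : ∀ t < T + M, R.act t = r₁.act t := fun t ht => by
    rw [hR, splice_act_of_lt (by omega), splice_act_of_lt ht]
  have hact0 : ∀ t < T, R.act t = r.act t := fun t ht => by
    rw [hact1 t (by omega), hr₁, splice_act_of_lt ht]
  have hact2 : ∀ t < T + M + M', R.act t = (splice r₁ (T + M) q').act t := fun t ht => by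
    rw [hR, splice_act_of_lt ht]
  have hM := hq.ends.lt
  have hM' := hq'.ends.lt
  dsimp only at hM hM'
  have hα : Invoked R (k, T + 1) (.write w) := by
    rw [Invoked, hact1 _ (by dsimp only; omega), hr₁, splice_act_add]
    exact hq.invoked
  have hαe : EndsAt R (k, T + 1) (T + M) p := (hq.ends.splice_add r T).congr hact1
  have hβ : Invoked R (k', T + M + 1) .read := by
    rw [Invoked, hact2 _ (by dsimp only; omega), splice_act_add]
    exact hq'.invoked
  have hβe : EndsAt R (k', T + M + 1) (T + M + M') (.value v) :=
    (hq'.ends.splice_add r₁ (T + M)).congr hact2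
  refine value_eq_of_linearizableRun (hLin R hex hfair) hα hαe hβ hβe
    -- The real-time order is strict. The idle round that opens the read makes it start at `T + M +
    -- 1`, after the write ended at `T + M`.
    ⟨_, _, hαe, by dsimp only; omega⟩ ?_
  rintro ⟨i, t⟩ o' hi h1 h2
  -- Operations invoked before `T` are over by `T`, while the write starts at `T + 1`. No others are
  -- left besides the write and the read.
  rcases lt_or_ge t T with ht | ht
  · obtain ⟨e, p', he, heT⟩ := hQ i t o' ht (by rw [Invoked, ← hact0 t ht]; exact hi)
    exact ⟨e, p', he.congr fun u hu => hact0 u (by omega), by dsimp only; omega⟩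
  exfalso
  rcases lt_or_ge t (T + M) with ht' | ht'
  · obtain ⟨u, rfl⟩ := Nat.exists_eq_add_of_le ht
    rw [Invoked, hact1 _ ht', hr₁, splice_act_add] at hi
    obtain ⟨rfl, rfl, -⟩ := hq.only u (by omega) _ _ hi
    exact h1 rfl
  rcases lt_or_ge t (T + M + M') with ht'' | ht''
  · obtain ⟨u, rfl⟩ := Nat.exists_eq_add_of_le ht'
    rw [Invoked, hact2 _ ht'', splice_act_add] at hi
    obtain ⟨rfl, rfl, -⟩ := hq'.only u (by omega) _ _ hi
    exact h2 rfl
  · obtain ⟨u, rfl⟩ := Nat.exists_eq_add_of_le ht''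
    rw [Invoked, hR, splice_act_add, hzenv] at hi
    simp at hi

end

/-! ### Exchanging two operations without fences and RMWs -/

section

variable {n : ℕ} {X D A L : Type*} [DecidableEq X] {I : Implementation n X D A L}

theorem readVal_frozen_of_ne (g : Global n X D A L) {i k : Fin n} (h : i ≠ k) (w : List (X × D))
    (l : Local X D A L) : readVal (g.frozen k w l).tso i = readVal g.tso i := by
  funext x
  simp [readVal, Global.frozen, h]

/-- In an obstruction-free linearizable implementation, an operation on `a` and a write of `b`
cannot both have traces from a common state without fences and read-modify-writes: they could be
performed in either order, with the same resulting state. -/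
theorem false_of_traces {v₀ : A} (hOF : ObstructionFree I) (hLin : Linearizable I v₀)
    {r : Run n X D A L} {T : ℕ} (hr : InitSeg I r T) (hQ : Quiet r T) {i j : Fin n} (hji : j ≠ i)
    {a b : A} (hab : b ≠ a) {o : Op A} {p p' : Resp A} (hval : IsValueOp a o p)
    (hfo : Fresh o r T) (hfb : Fresh (.write b) r T)
    {V V' : ℕ → X → D} {l l' : ℕ → Local X D A L} {c c' : ℕ → Act X D A L} {m m' : ℕ}
    (h : Trace I i V l c (m + 1)) (hV : V 0 = readVal (r.state T).tso i)
    (hl : l 0 = (r.state T).loc i ++ [.invoke o]) (hret : c m = .ret p)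
    (hne : ∀ u < m, ∀ z, c u ≠ .ret z)
    (h' : Trace I j V' l' c' (m' + 1)) (hV' : V' 0 = readVal (r.state T).tso j)
    (hl' : l' 0 = (r.state T).loc j ++ [.invoke (.write b)]) (hret' : c' m' = .ret p')
    (hne' : ∀ u < m', ∀ z, c' u ≠ .ret z) : False := by
  have hpend := hQ.pending_eq_none hr
  obtain ⟨qX, hqX, hsX⟩ := h.exists_opSeg hV hl (hpend i) hret hne
  obtain ⟨qB, hqB, hsB⟩ := h'.exists_opSeg hV' hl' (hpend j) hret' hne'
  -- Each operation leaves the view and the local state of the other process unchanged, so each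
  -- trace can also be replayed after the other one.
  obtain ⟨qX', hqX', hsX'⟩ := h.exists_opSeg (g := qB.state (2 + (m' + 1))) (o := o)
    (by rw [hsB, readVal_frozen_of_ne _ hji.symm, hV])
    (by rw [hsB, loc_frozen_of_ne _ hji.symm, hl])
    (by rw [hsB, loc_frozen_of_ne _ hji.symm, hpend]) hret hne
  obtain ⟨qB', hqB', hsB'⟩ := h'.exists_opSeg (g := qX.state (2 + (m + 1))) (o := .write b)
    (by rw [hsX, readVal_frozen_of_ne _ hji, hV'])
    (by rw [hsX, loc_frozen_of_ne _ hji, hl'])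
    (by rw [hsX, loc_frozen_of_ne _ hji, hpend]) hret' hne'
  rcases hval with ⟨rfl, rfl⟩ | ⟨rfl, rfl⟩
  -- A read replayed after `Write(b)` still returns `a`.
  · exact hab (value_eq_of_opSeg hLin hr hQ hqB hfb hqX').symm
  have hrX := hqX.initSeg hr hfo
  have hQX := hqX.quiet hQ
  have hfX : Fresh (.write b) _ _ := hqX.fresh hfb fun v hv => by
    simpa using fun hva => hab ((Op.write.inj hv).trans hva.symm)
  have hrB := hqB.initSeg hr hfb
  have hQB := hqB.quiet hQ
  have hfB : Fresh (.write a) _ _ := hqB.fresh hfo fun v hv => by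
    simpa using fun hvb => hab (hvb.trans (Op.write.inj hv).symm)
  have hstX := splice_state_add r qX T (2 + (m + 1))
  have hstB := splice_state_add r qB T (2 + (m' + 1))
  rw [← hstX] at hqB'
  rw [← hstB] at hqX'
  have hrXB := hqB'.initSeg hrX hfX
  have hQXB := hqB'.quiet hQX
  -- For a write, the order is tested by a read of `j`, performed after `X` and then `Write(b)`.
  obtain ⟨q, M, pR, hq, hfits, -⟩ := hrXB.exists_opSeg hOF (hQXB.pending_eq_none hrXB j)
    (o := .read) (fun v hv => by simp at hv)
  rw [splice_state_add] at hq
  cases pR with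
  | ack => exact hfits
  | value v =>
    have h1 : v = b := value_eq_of_opSeg hLin hrX hQX hqB' hfX hq
    -- The opposite order ends in the same state, so the very same read segment follows it too.
    have hst : qB'.state (2 + (m' + 1)) = qX'.state (2 + (m + 1)) := by
      rw [hsB', hsX', hsX, hsB, Global.frozen_comm _ hji.symm]
    rw [hst] at hq
    have h2 : v = a := value_eq_of_opSeg hLin hrB hQB hqX' hfB hq
    exact hab (h1.symm.trans h2)

end

end TSO

/-! ### The main theorem -/

theorem mainTheorem5 {n : ℕ} {X D A L : Type*} [DecidableEq X]
    (I : TSO.Implementation n X D A L) (v₀ : A)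
    (hOF : TSO.ObstructionFree I) (hLin : TSO.Linearizable I v₀)
    (a b : A) (hab : b ≠ a)
    (r : TSO.Run n X D A L) (hr : TSO.IsExecution I r)
    (i : Fin n) (s e : ℕ) (o : TSO.Op A) (p : TSO.Resp A)
    (hinv : TSO.Invoked r (i, s) o) (hend : TSO.EndsAt r (i, s) e p)
    (hval : TSO.IsValueOp a o p)
    (hsolo : TSO.Solo r i s e) (hiso : TSO.InIsolation r (i, s))
    (hsync : ¬ TSO.ContainsSync r i s e)
    (hfresh : ∀ t k, t < e → ¬ TSO.Invoked r (k, t) (.write b))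
    (j : Fin n) (hji : j ≠ i) :
    ∃ (r' : TSO.Run n X D A L) (s' e' : ℕ),
      TSO.IsExecution I r' ∧ TSO.IsFair I r' ∧
      TSO.IndistUntil r r' i e ∧
      TSO.Invoked r' (i, s) o ∧ TSO.EndsAt r' (i, s) e p ∧
      TSO.Invoked r' (j, s') (.write b) ∧ TSO.EndsAt r' (j, s') e' .ack ∧
      TSO.Precedes r' (i, s) (j, s') ∧
      TSO.ContainsSync r' j s' e' := by
  open TSO in
  obtain ⟨t₁, he, hst₁, hret, hnoret⟩ := id hend
  dsimp only at hst₁ hret hnoret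
  -- The process acts before the environment in round `s`, so the actions of `X` are those of the
  -- rounds from `s + 1` to `s + 1 + m`, the last being the return.
  obtain ⟨m, rfl⟩ : ∃ m, t₁ = s + 1 + m := ⟨t₁ - (s + 1), by omega⟩
  have he' : s + 1 + (m + 1) = e := by omega
  -- the operations invoked before the end of the given one
  have hnew : ∀ t k o', s ≤ t → t < e → Invoked r (k, t) o' → k = i ∧ t = s := by
    intro t k o' h1 h2 hi
    by_contra hne
    have hne' : ((k, t) : Fin n × ℕ) ≠ (i, s) := fun h => hne (by simpa using h)
    rcases hiso _ _ hi hne' with ⟨e', p', h3, h4⟩ | ⟨e', p', h3, h4⟩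
    · have := h3.unique hend
      dsimp only at h4
      omega
    · have := h3.lt
      dsimp only at h4 this
      omega
  have hold : ∀ t k o', t < s → Invoked r (k, t) o' → ∃ e' p', EndsAt r (k, t) e' p' ∧ e' < s := by
    intro t k o' h1 hi
    have hne' : ((k, t) : Fin n × ℕ) ≠ (i, s) := fun h => by
      simp only [Prod.mk.injEq] at h; omega
    rcases hiso _ _ hi hne' with ⟨e', p', h3, h4⟩ | ⟨e', p', h3, h4⟩
    · have := h3.unique hend
      dsimp only at h4
      omega
    · exact ⟨e', p', h3, h4⟩
  -- the trace of the operation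
  have hX := trace_of_solo (I := I) (q := r) (T := s + 1) (m := m + 1) i (hr.initSeg _).toSeg
    (fun u hu k hk => hsolo _ (by omega) (by omega) k hk)
    (fun u hu => by
      by_contra h
      obtain ⟨o', ho'⟩ := Option.ne_none_iff_exists'.1 h
      have := (hnew (s + 1 + u) i o' (by omega) (by omega) ho').2
      omega)
    (fun u hu h => hsync ⟨s + 1 + u, by omega, by omega, h⟩)
  set V : ℕ → X → D := fun u => readVal (r.state (s + 1 + u)).tso i with hV
  set l : ℕ → Local X D A L := fun u => (r.state (s + 1 + u)).loc i with hl
  set c : ℕ → Act X D A L := fun u => (r.act (s + 1 + u)).proc i with hc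
  set G := r.state (s + 1) with hG
  have hcret : c m = .ret p := hret
  have hcne : ∀ u < m, ∀ z, c u ≠ .ret z := fun u hu z =>
    hnoret (s + 1 + u) (by omega) (by omega) z
  have hV0 : V 0 = readVal G.tso i := rfl
  have hl0 : l 0 = G.loc i := rfl
  -- the run with all propagations during the operation suppressed
  set R := splice r (s + 1) (block G i c) with hR
  have hb0 : (block G i c).state 0 = r.state (s + 1) := rfl
  have hRlt : ∀ t < s + 1, R.act t = r.act t := fun t ht => splice_act_of_lt ht
  have hRenv : ∀ t k o', t < e → Invoked R (k, t) o' → t < s + 1 ∧ Invoked r (k, t) o' := by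
    intro t k o' ht hi
    rcases lt_or_ge t (s + 1) with h | h
    · exact ⟨h, by rwa [Invoked, hRlt t h] at hi⟩
    · obtain ⟨u, rfl⟩ := Nat.exists_eq_add_of_le h
      simp [Invoked, hR, block_act, Joint.single] at hi
  have hRinit : InitSeg I R e := by
    rw [← he']
    refine (hr.initSeg (s + 1)).append (hX.block_seg hV0 hl0) hb0 (o := .read) (k := i) (s := 0)
      (fun v hv => by simp at hv) (fun t _ k o' hi => ?_)
    simp [block_act, Joint.single] at hi
  have hRends : EndsAt R (i, s) e p := by
    refine ⟨s + 1 + m, he, hst₁, ?_, fun u h1 h2 z => ?_⟩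
    · simpa [hR, block_act, Joint.single] using hcret
    · dsimp only at h1
      obtain ⟨v, rfl⟩ : ∃ v, u = s + 1 + v := ⟨u - (s + 1), by omega⟩
      simpa [hR, block_act, Joint.single] using hcne v (by omega) z
  have hRquiet : Quiet R e := by
    intro k t o' ht hi
    obtain ⟨hts, hi'⟩ := hRenv t k o' ht hi
    rcases lt_or_ge t s with h | h
    · obtain ⟨e', p', h1, h2⟩ := hold t k o' h hi'
      exact ⟨e', p', h1.congr fun u hu => hRlt u (by omega), by omega⟩
    · obtain ⟨rfl, rfl⟩ := hnew t k o' h ht hi'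
      exact ⟨e, p, hRends, le_rfl⟩
  have hRfresh : Fresh (.write b) R e := by
    rintro v hv t ht k hi
    obtain rfl := Op.write.inj hv
    exact hfresh t k ht (hRenv t k _ ht hi).2
  -- At the end of `X`, memory is still that of `G`, and all that `X` wrote is hidden in the buffer
  -- of `i`.
  have hRe : R.state e = G.frozen i (items c (m + 1)) (l (m + 1)) := by
    rw [← he', hR, splice_state_add, (hX.block_state hV0 hl0 le_rfl).1]
  obtain ⟨q, M, pB, hq, hfits, hq2, hqsolo⟩ :=
    hRinit.exists_opSeg hOF (hRquiet.pending_eq_none hRinit j) hRfresh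
  obtain rfl : pB = .ack := by
    cases pB with
    | ack => rfl
    | value v => exact hfits.elim
  -- Either the write of `j` synchronizes and this run can be continued fairly, or it is a second
  -- sync-free trace.
  by_cases hqs : ContainsSync q j 1 M
  · obtain ⟨z, hz0, -, hex, hfair⟩ := (hq.initSeg hRinit hRfresh).exists_fair j
    have hact : ∀ t < e + M, (splice (splice R e q) (e + M) z).act t = (splice R e q).act t :=
      fun t ht => splice_act_of_lt ht
    have hactR : ∀ t < e, (splice (splice R e q) (e + M) z).act t = R.act t := fun t ht => by
      rw [hact t (by omega), splice_act_of_lt ht]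
    have hM := hq.ends.lt
    dsimp only at hM
    have hends : EndsAt (splice (splice R e q) (e + M) z) (i, s) e p := hRends.congr hactR
    refine ⟨splice (splice R e q) (e + M) z, e + 1, e + M, hex, hfair, ?_, ?_, hends, ?_,
      (hq.ends.splice_add R e).congr hact, ⟨e, p, hends, by dsimp only; omega⟩, ?_⟩
    · intro t ht
      rw [splice_state_of_le hz0 (by omega), splice_state_of_le hq.start ht]
      rcases le_or_gt t (s + 1) with h | h
      · rw [hR, splice_state_of_le hb0 h]
      · obtain ⟨u, rfl⟩ := Nat.exists_eq_add_of_le h.le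
        rw [hR, splice_state_add, (hX.block_state hV0 hl0 (by omega)).1]
        simp [Global.frozen, hl]
    · rw [Invoked, hactR _ (by dsimp only; omega), hRlt _ (by dsimp only; omega)]
      exact hinv
    · rw [Invoked, hact _ (by dsimp only; omega), splice_act_add]
      exact hq.invoked
    · obtain ⟨t, h1, h2, h3⟩ := hqs
      refine ⟨e + t, by omega, by omega, ?_⟩
      rw [hact _ (by omega), splice_act_add]
      exact h3
  · exfalso
    obtain ⟨t₂, hM, h1, hret', hnoret'⟩ := id hq.ends
    dsimp only at h1 hret' hnoret'
    obtain ⟨m', rfl⟩ : ∃ m', t₂ = 2 + m' := ⟨t₂ - 2, by omega⟩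
    obtain rfl : M = 2 + (m' + 1) := by omega
    have hB := trace_of_solo (I := I) (q := q) (T := 2) (m := m' + 1) j hq.seg
      (fun u _ k hk => hqsolo _ k hk)
      (fun u hu => by
        by_contra h
        obtain ⟨o', ho'⟩ := Option.ne_none_iff_exists'.1 h
        have := (hq.only (2 + u) (by omega) j o' ho').2.1
        omega)
      (fun u hu h => hqs ⟨2 + u, by omega, by omega, h⟩)
    -- the run in which the operation of `i` is not invoked
    set d : Joint n X D A L := { r.act s with env := fun _ => none } with hd
    set w := gen (r.state s) (fun _ _ => d) with hw
    have hw0 : w.state 0 = r.state s := rfl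
    have hwseg : Seg I w 1 := by
      refine ⟨fun t ht => ?_, fun t _ => rfl, fun t ht => ?_⟩
      · obtain rfl : t = 0 := by omega
        have h := hr.enabled s
        exact ⟨h.proc, h.disp, fun k hk => absurd rfl hk, h.no_conflict⟩
      · obtain rfl : t = 0 := by omega
        exact hr.follows s
    have hr0lt : ∀ t < s, (splice r s w).act t = r.act t := fun t ht => splice_act_of_lt ht
    have hr0 : InitSeg I (splice r s w) (s + 1) :=
      (hr.initSeg s).append hwseg hw0 (o := .read) (k := i) (s := 0)
        (fun v hv => by simp at hv) (fun t _ k o' hi => by simp [hw, gen, hd] at hi)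
    have hr0env : ∀ t k o', t < s + 1 → Invoked (splice r s w) (k, t) o' →
        t < s ∧ Invoked r (k, t) o' := by
      intro t k o' ht hi
      rcases lt_or_ge t s with h | h
      · exact ⟨h, by rwa [Invoked, hr0lt t h] at hi⟩
      · obtain ⟨u, rfl⟩ := Nat.exists_eq_add_of_le h
        rw [Invoked, splice_act_add] at hi
        simp [hw, gen, hd] at hi
    have hQ0 : Quiet (splice r s w) (s + 1) := by
      intro k t o' ht hi
      obtain ⟨hts, hi'⟩ := hr0env t k o' ht hi
      obtain ⟨e', p', h3, h4⟩ := hold t k o' hts hi'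
      exact ⟨e', p', h3.congr fun u hu => hr0lt u (by omega), by omega⟩
    have hstate : (splice r s w).state (s + 1) = next (r.state s) d := by
      rw [splice_state_add]; rfl
    have hGstep : G = next (r.state s) (r.act s) := hr.step s
    -- Round `s` is kept except for the invocation, since `i` or its dispatcher may move in it. An
    -- invocation does not affect memory or buffers.
    have htso : ((splice r s w).state (s + 1)).tso = G.tso := by
      rw [hstate, hGstep]; rfl
    have hlocj : ((splice r s w).state (s + 1)).loc j = G.loc j := by
      have henvj : (r.act s).env j = none := by
        by_contra h
        obtain ⟨o', ho'⟩ := Option.ne_none_iff_exists'.1 h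
        exact hji (hnew s j o' le_rfl (by omega) ho').1
      rw [hstate, hGstep, next_loc, next_loc, henvj]
    have hloci : G.loc i = ((splice r s w).state (s + 1)).loc i ++ [.invoke o] := by
      have henvi : (r.act s).env i = some o := hinv
      rw [hstate, hGstep, next_loc, next_loc, henvi]
      simp [hd]
    refine false_of_traces hOF hLin hr0 hQ0 hji hab hval ?_ ?_ hX (by rw [htso]) hloci hcret hcne
      hB ?_ ?_ hret' ?_
    -- If `X` is a write, its value was not written earlier because `r` itself writes it at time
    -- `s`.
    · rintro v rfl t ht k hi
      obtain ⟨hts, hi'⟩ := hr0env t k _ ht hi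
      have := (hr.write_once v t s k i hi' hinv).1
      omega
    · intro v hv t ht k hi
      obtain rfl := Op.write.inj hv
      exact hfresh t k (by omega) (hr0env t k _ ht hi).2
    -- Although `j` ran after `X`, its view and local state were those of `G`, so its trace also
    -- starts from the state without `X`.
    · rw [htso, add_zero, hq2, hRe]
      exact readVal_frozen_of_ne G hji (items c (m + 1)) (l (m + 1))
    · rw [add_zero, hq2, hRe, hlocj]
      simp only [Function.update_self]
      rw [loc_frozen_of_ne _ hji]
    · intro u hu z
      exact hnoret' (2 + u) (by omega) (by omega) z
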